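/- Let $d_1,d_2\ge 1$, let $K$ be a totally real number field of degree $d_1+d_2$ with ring of integers $\mathcal O_K$, and let $\sigma_1,\dots,\sigma_{d_1+d_2}:K\to\mathbb R$ be its field embeddings, in any order. Let $\Gamma<\mathbb R^{d_1}\times\mathbb R^{d_2}$ be a lattice that projects injectively to $\mathbb R^{d_1}$ and densely to $\mathbb R^{d_2}$, and whose dual lattice $\Gamma^\perp=\{\xi : \langle\xi,\gamma\rangle\in\mathbb Z \text{ for all }\gamma\in\Gamma\}$ is arithmetic: \[ \Gamma^\perp=\{(\sigma_1(a),\dots,\sigma_{d_1+d_2}(a)) : a\in\mathcal O_K\}. \] For a bounded Borel set $W\subset\mathbb R^{d_2}$ with dense interior (that is, $W\subset\overline{W^\circ}$), let $p=p(\mathbb R^{d_1},\mathbb R^{d_2},\Gamma,W)$ be the cut-and-project process: on the torus $\Omega=(\mathbb R^{d_1}\times\mathbb R^{d_2})/\Gamma$ with its invariant probability measure, $p$ sends the class of $(g,h)$ to $\sum_{x\in\Lambda}\delta_x$, where $\Lambda=\mathrm{pr}_{\mathbb R^{d_1}}\big(\Gamma\cap(\mathbb R^{d_1}\times(W-h))\big)+g$.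 Its centered diffraction $\widehat\eta_p$ is the Radon measure on $\mathbb R^{d_1}$ with $\int|\widehat f|^2\,d\widehat\eta_p=\mathrm{Var}(p(f))$ for all $f\in C_c(\mathbb R^{d_1})$, where $\widehat f(\xi)=\int f(x)e^{-2\pi i\langle x,\xi\rangle}dx$. The process $p$ is called hyperuniform if it is locally square-integrable and $\widehat\eta_p(B_\varepsilon)/\mathrm{Vol}_{d_1}(B_\varepsilon)\to0$ as $\varepsilon\to0^+$, where $B_\varepsilon$ is the Euclidean ball of radius $\varepsilon$ around $0$ in $\mathbb R^{d_1}$. (1) Suppose that $W$ is Fourier smooth with exponent $\vartheta>0$, that is, there is a constant $C'$ with $|\widehat{\chi}_W(\xi)|\le C'(1+\|\xi\|)^{-(d_2+\vartheta)/2}$ for all $\xi\in\mathbb R^{d_2}$. Then $p$ is hyperuniform, and there is a constant $C>0$ such that for all $\varepsilon>0$ \[ \frac{\widehat\eta_p(B_\varepsilon)}{\mathrm{Vol}_{d_1}(B_\varepsilon)}\le C\,\varepsilon^{d_1\vartheta/d_2}. \] (2) If $W$ is an (open or closed) Euclidean ball of positive radius in $\mathbb R^{d_2}$, then $p$ is hyperuniform,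 and there is a constant $C>0$ such that for all $\varepsilon>0$ \[ \frac{\widehat\eta_p(B_\varepsilon)}{\mathrm{Vol}_{d_1}(B_\varepsilon)}\le C\,\varepsilon^{d_1/d_2}. \] -/

import Mathlib

open MeasureTheory Filter Topology Metric
open scoped FourierTransform ENNReal Pointwise

namespace CutProject

/-- The Euclidean space `ℝ^d`. -/
abbrev Euc (d : ℕ) : Type := EuclideanSpace ℝ (Fin d)

/-! ### Random measures on Euclidean space, centered diffraction, hyperuniformity -/

section RandomMeasure

variable {d : ℕ} {Ω : Type*} [MeasurableSpace Ω]

/-- The linear statistic `ω ↦ p_ω(f)` of a random measure `p`. -/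
noncomputable def linearStatistic (p : Ω → Measure (Euc d)) (f : Euc d → ℂ) (ω : Ω) : ℂ :=
  ∫ x, f x ∂(p ω)

/-- The variance `𝔼 |X - 𝔼 X|²` of a complex random variable, with values in `[0, ∞]`. -/
noncomputable def complexVariance (P : Measure Ω) (X : Ω → ℂ) : ℝ≥0∞ :=
  ∫⁻ ω, ‖X ω - ∫ ω', X ω' ∂P‖ₑ ^ 2 ∂P

/-- `p` is a random measure with `𝔼 [p(B)²] < ∞` for every bounded Borel set `B`. -/
structure IsLocallySquareIntegrable (P : Measure Ω) (p : Ω → Measure (Euc d)) : Prop where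
  measurable : Measurable p
  lintegral_sq_lt_top : ∀ B : Set (Euc d), MeasurableSet B → Bornology.IsBounded B →
    ∫⁻ ω, p ω B ^ 2 ∂P < ∞

/-- `η` is the centered diffraction of the random measure `p`: it is a Radon measure with
`∫ |𝓕 f|² dη = Var (p(f))` for all compactly supported continuous `f`, where
`𝓕 f ξ = ∫ f x * exp (-2πi⟪x, ξ⟫) dx`. That is, `η` is the Fourier transform of the centered
autocorrelation measure of `p`, whose value at `f ∗ f^*` is `Var (p(f))`. -/
structure IsCenteredDiffraction (P : Measure Ω) (p : Ω → Measure (Euc d))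
    (η : Measure (Euc d)) : Prop where
  isLocallyFinite : IsLocallyFiniteMeasure η
  lintegral_sq : ∀ f : Euc d → ℂ, Continuous f → HasCompactSupport f →
    ∫⁻ ξ, ‖𝓕 f ξ‖ₑ ^ 2 ∂η = complexVariance P (linearStatistic p f)

/-- (Spectral) hyperuniformity of a locally square-integrable random measure: the centered
diffraction `η` of `p` satisfies `η(B_ε) / Vol(B_ε) → 0` as `ε → 0`. -/
def IsHyperuniform (P : Measure Ω) (p : Ω → Measure (Euc d)) : Prop :=
  IsLocallySquareIntegrable P p ∧
    ∃ η : Measure (Euc d), IsCenteredDiffraction P p η ∧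
      Tendsto (fun ε : ℝ => η (ball 0 ε) / volume (ball (0 : Euc d) ε)) (𝓝[>] 0) (𝓝 0)

/-- The centered diffraction `η` of `p` satisfies `η(B_ε) / Vol(B_ε) ≪ ε^κ`. -/
def DiffractionDecay (P : Measure Ω) (p : Ω → Measure (Euc d)) (κ : ℝ) : Prop :=
  ∀ η : Measure (Euc d), IsCenteredDiffraction P p η →
    ∃ C : ℝ, 0 < C ∧ ∀ ε : ℝ, 0 < ε →
      η (ball 0 ε) / volume (ball (0 : Euc d) ε) ≤ ENNReal.ofReal (C * ε ^ κ)

end RandomMeasure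

/-! ### Windows -/

/-- A window: a bounded Borel set with dense interior. -/
structure IsWindow {d : ℕ} (W : Set (Euc d)) : Prop where
  measurableSet : MeasurableSet W
  isBounded : Bornology.IsBounded W
  subset_closure_interior : W ⊆ closure (interior W)

/-- `W` is Fourier smooth with exponent `ϑ > 0`:
`|𝓕 χ_W (ξ)| ≪ (1 + ‖ξ‖) ^ (-(d + ϑ) / 2)` for all `ξ`. -/
def IsFourierSmooth {d : ℕ} (W : Set (Euc d)) (ϑ : ℝ) : Prop :=
  0 < ϑ ∧ ∃ C : ℝ, ∀ ξ : Euc d,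
    ‖𝓕 (W.indicator (fun _ => (1 : ℂ))) ξ‖ ≤ C * (1 + ‖ξ‖) ^ (-((d : ℝ) + ϑ) / 2)

/-! ### Lattices in products -/

section Lattice

variable {d₁ d₂ : ℕ}

/-- The dual lattice `Γ^⊥`, i.e. all `ξ` such that the character `exp (2πi⟪ξ, ·⟫)` is trivial
on `Γ`. -/
def dualLattice (Γ : Submodule ℤ (Euc d₁ × Euc d₂)) : Set (Euc d₁ × Euc d₂) :=
  {ξ | ∀ γ ∈ Γ, ∃ n : ℤ, inner ℝ ξ.1 γ.1 + inner ℝ ξ.2 γ.2 = (n : ℝ)}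

/-- `Γ` projects injectively to the first factor and densely to the second factor. -/
structure IsCutProjectLattice (Γ : Submodule ℤ (Euc d₁ × Euc d₂)) : Prop where
  injOn_fst : Set.InjOn Prod.fst (Γ : Set (Euc d₁ × Euc d₂))
  dense_snd : Dense (Prod.snd '' (Γ : Set (Euc d₁ × Euc d₂)))

/-- The image of the ring of integers of `K` in `ℝ^{d₁} × ℝ^{d₂}` under
`a ↦ (σ₁ a, …, σ_{d₁ + d₂} a)`, for an enumeration `σ` of the real embeddings of `K`. -/
noncomputable def arithmeticLattice {K : Type*} [Field K]
    (σ : Fin d₁ ⊕ Fin d₂ → (K →+* ℝ)) : Set (Euc d₁ × Euc d₂) :=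
  Set.range fun a : NumberField.RingOfIntegers K =>
    (WithLp.toLp 2 fun i => σ (Sum.inl i) (a : K), WithLp.toLp 2 fun j => σ (Sum.inr j) (a : K))

/-- The probability space `Ω = (ℝ^{d₁} × ℝ^{d₂}) / Γ`. -/
abbrev Torus (Γ : Submodule ℤ (Euc d₁ × Euc d₂)) : Type :=
  (Euc d₁ × Euc d₂) ⧸ Γ.toAddSubgroup

/-- The fundamental parallelotope of `Γ` for some `ℤ`-basis of `Γ`. -/
noncomputable def fundDomain (Γ : Submodule ℤ (Euc d₁ × Euc d₂)) [DiscreteTopology Γ]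
    [IsZLattice ℝ Γ] : Set (Euc d₁ × Euc d₂) :=
  ZSpan.fundamentalDomain ((Module.Free.chooseBasis ℤ Γ).ofZLatticeBasis ℝ Γ)

/-- The invariant probability measure on the torus: the image of normalized Lebesgue measure
on a fundamental domain. -/
noncomputable def torusMeasure (Γ : Submodule ℤ (Euc d₁ × Euc d₂)) [DiscreteTopology Γ]
    [IsZLattice ℝ Γ] : Measure (Torus Γ) :=
  (ProbabilityTheory.cond volume (fundDomain Γ)).map QuotientAddGroup.mk

instance isAddHaarMeasure_volume_prod :
    (volume : Measure (Euc d₁ × Euc d₂)).IsAddHaarMeasure :=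
  inferInstanceAs
    ((volume : Measure (Euc d₁)).prod (volume : Measure (Euc d₂))).IsAddHaarMeasure

theorem isAddFundamentalDomain_fundDomain (Γ : Submodule ℤ (Euc d₁ × Euc d₂))
    [DiscreteTopology Γ] [IsZLattice ℝ Γ] :
    IsAddFundamentalDomain Γ (fundDomain Γ) (volume : Measure (Euc d₁ × Euc d₂)) :=
  ZLattice.isAddFundamentalDomain (Module.Free.chooseBasis ℤ Γ) volume

theorem measurableSet_fundDomain (Γ : Submodule ℤ (Euc d₁ × Euc d₂))
    [DiscreteTopology Γ] [IsZLattice ℝ Γ] : MeasurableSet (fundDomain Γ) :=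
  ZSpan.fundamentalDomain_measurableSet _

/-- The measure `torusMeasure Γ` is a probability measure. -/
instance isProbabilityMeasure_torusMeasure (Γ : Submodule ℤ (Euc d₁ × Euc d₂))
    [DiscreteTopology Γ] [IsZLattice ℝ Γ] : IsProbabilityMeasure (torusMeasure Γ) := by
  have h0 : volume (fundDomain Γ) ≠ 0 := ZSpan.measure_fundamentalDomain_ne_zero _
  have h1 : volume (fundDomain Γ) ≠ ∞ :=
    (ZSpan.fundamentalDomain_isBounded _).measure_lt_top.ne
  have : IsProbabilityMeasure (ProbabilityTheory.cond volume (fundDomain Γ)) :=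
    ProbabilityTheory.cond_isProbabilityMeasure_of_finite h0 h1
  exact Measure.isProbabilityMeasure_map measurable_quot_mk.aemeasurable

/-- The measure `torusMeasure Γ` is invariant under all translations of the torus. -/
theorem torusMeasure_map_add (Γ : Submodule ℤ (Euc d₁ × Euc d₂))
    [DiscreteTopology Γ] [IsZLattice ℝ Γ] (v : Euc d₁ × Euc d₂) :
    (torusMeasure Γ).map (fun ω => ω + (QuotientAddGroup.mk v : Torus Γ)) =
      torusMeasure Γ := by
  have hmk : Measurable (QuotientAddGroup.mk : Euc d₁ × Euc d₂ → Torus Γ) := measurable_quot_mk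
  have hadd : Measurable (fun ω : Torus Γ => ω + (QuotientAddGroup.mk v : Torus Γ)) := by
    refine measurable_from_quotient.2 ?_
    exact hmk.comp (measurable_id.add_const v)
  ext A hA
  have hB : MeasurableSet ((QuotientAddGroup.mk : Euc d₁ × Euc d₂ → Torus Γ) ⁻¹' A) := hmk hA
  rw [Measure.map_apply hadd hA, torusMeasure, Measure.map_apply hmk (hadd hA),
    Measure.map_apply hmk hA, ProbabilityTheory.cond_apply (measurableSet_fundDomain Γ),
    ProbabilityTheory.cond_apply (measurableSet_fundDomain Γ)]
  congr 1
  have hF := isAddFundamentalDomain_fundDomain Γ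
  have hFv : IsAddFundamentalDomain Γ (v +ᵥ fundDomain Γ)
      (volume : Measure (Euc d₁ × Euc d₂)) := hF.vadd_of_comm v
  have hset : fundDomain Γ ∩ (QuotientAddGroup.mk ⁻¹'
      ((fun ω : Torus Γ => ω + (QuotientAddGroup.mk v : Torus Γ)) ⁻¹' A)) =
      (fun x : Euc d₁ × Euc d₂ => x + v) ⁻¹' ((QuotientAddGroup.mk ⁻¹' A) ∩
        (v +ᵥ fundDomain Γ)) := by
    ext x
    simp only [Set.mem_inter_iff, Set.mem_preimage, QuotientAddGroup.mk_add,
      Set.mem_vadd_set_iff_neg_vadd_mem, vadd_eq_add, add_comm x v,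
      neg_add_cancel_left]
    rw [and_comm, add_comm (QuotientAddGroup.mk x : Torus Γ)]
  have : VAddInvariantMeasure Γ (Euc d₁ × Euc d₂) volume :=
    ⟨fun γ s _ => measure_preimage_add volume (γ : Euc d₁ × Euc d₂) s⟩
  rw [hset, measure_preimage_add_right, Set.inter_comm (fundDomain Γ)]
  refine (hF.measure_set_eq hFv hB fun γ => ?_).symm
  ext x
  simp only [Set.mem_preimage]
  have hq : (QuotientAddGroup.mk (γ +ᵥ x) : Torus Γ) = QuotientAddGroup.mk x := by
    refine (QuotientAddGroup.eq.2 ?_).symm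
    have : -x + (γ +ᵥ x) = (γ : Euc d₁ × Euc d₂) := by
      change -x + ((γ : Euc d₁ × Euc d₂) + x) = _
      abel
    rw [this]
    exact γ.2
  rw [hq]

/-- The cut-and-project set `pr₁ (Γ ∩ (ℝ^{d₁} × W))`. -/
def cutProjectSet (Γ : Submodule ℤ (Euc d₁ × Euc d₂)) (W : Set (Euc d₂)) : Set (Euc d₁) :=
  Prod.fst '' ((Γ : Set (Euc d₁ × Euc d₂)) ∩ Set.univ ×ˢ W)

/-- The random set of the cut-and-project process: for `ω` the class of `(g, h)` this is the
projection to `ℝ^{d₁}` of `((g, h) + Γ) ∩ (ℝ^{d₁} × W)`, which is `Λ(Γ, W - h) + g`, see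
`randomSet_mk`. -/
def randomSet (Γ : Submodule ℤ (Euc d₁ × Euc d₂)) (W : Set (Euc d₂)) (ω : Torus Γ) :
    Set (Euc d₁) :=
  {g | ∃ h ∈ W, (QuotientAddGroup.mk (g, h) : Torus Γ) = ω}

theorem randomSet_mk (Γ : Submodule ℤ (Euc d₁ × Euc d₂)) (W : Set (Euc d₂))
    (g : Euc d₁) (h : Euc d₂) :
    randomSet Γ W (QuotientAddGroup.mk (g, h) : Torus Γ) =
      (fun x => x + g) '' cutProjectSet Γ ((fun y => y - h) '' W) := by
  ext x
  simp only [randomSet, cutProjectSet, Set.mem_ofPred_eq, Set.mem_image, Set.mem_inter_iff,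
    Set.mem_prod, Set.mem_univ, true_and, Prod.exists, SetLike.mem_coe]
  constructor
  · rintro ⟨k, hk, hq⟩
    have hq' := QuotientAddGroup.eq.1 hq.symm
    refine ⟨x - g, ⟨x - g, k - h, ⟨?_, k, hk, rfl⟩, rfl⟩, by simp⟩
    have : -(g, h) + (x, k) = (x - g, k - h) := by
      ext1 <;> simp [sub_eq_add_neg, add_comm]
    rw [this] at hq'
    exact hq'
  · rintro ⟨y, ⟨y', z, ⟨hz, k, hk, rfl⟩, rfl⟩, rfl⟩
    refine ⟨k, hk, ?_⟩
    refine (QuotientAddGroup.eq.2 ?_).symm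
    have : -(g, h) + (y' + g, k) = (y', k - h) := by
      ext1 <;> simp [sub_eq_add_neg, add_comm]
    rw [this]
    exact hz

/-- The cut-and-project process with parameters `(ℝ^{d₁}, ℝ^{d₂}, Γ, W)`, as a random measure on
the probability space `(Torus Γ, torusMeasure Γ)`: the sum of the point masses at the points of
the random set. -/
noncomputable def cutProjectProcess (Γ : Submodule ℤ (Euc d₁ × Euc d₂)) (W : Set (Euc d₂))
    (ω : Torus Γ) : Measure (Euc d₁) :=
  Measure.sum fun x : randomSet Γ W ω => Measure.dirac (x : Euc d₁)

end Lattice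

end CutProject

/-! Lifted to `ℝ^{d₁} × ℝ^{d₂}`, the statistic `p(f)` is the `Γ`-periodization of `f ⊗ χ_W`. Its
Fourier coefficients are indexed by `Γ^⊥` and equal `covol(Γ)⁻¹ 𝓕 f (ξ₁) 𝓕 χ_W (ξ₂)`. Parseval's
identity, with the term `ξ = 0` removed by centering, gives `Var (p(f))` as an explicit sum
(`complexVariance_linearStatistic`), so the pure point measure with mass `covol(Γ)⁻² |𝓕 χ_W (ξ₂)|²`
at `ξ₁`, for `0 ≠ ξ ∈ Γ^⊥`, has the defining property of a centered diffraction.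

Arithmeticity enters through one inequality: the coordinates of a nonzero `ξ ∈ Γ^⊥` multiply to the
norm of a nonzero algebraic integer, so the absolute value of the product is at least `1`. This has
two consequences. If `‖ξ₁‖ < R`, then `‖ξ₂‖ ≥ T₀ = R^{-d₁/d₂}`. Since differences of points of `Γ^⊥`
obey the same inequality, pigeonholing shows that `O(R^{d₁} T^{d₂})` nonzero points satisfy `‖ξ₁‖ <
R`, `‖ξ₂‖ < T` (`card_le_of_norm_lt`). Cutting `‖ξ₂‖ ≥ T₀` into dyadic shells, with weight `O((T₀
2^k)^{-(d₂+ϑ)})` on the `k`-th, leaves a geometric series of ratio `2^{-ϑ}` and the bound `O(R^{d₁ +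
d₁ϑ/d₂})` for the mass of `B_R` (`exists_diffractionMeasure_ball_le`).

The decay is claimed for every centered diffraction `η`. Uniqueness of `η` is not needed: a rescaled
test function with `|𝓕 f| ≥ 1` on `B_ε` gives `η(B_ε) ≤ Var (p(f))`, and this variance is an
integral against the explicit measure, controlled by its growth and the rapid decay of `𝓕 f`.

For a ball, slicing orthogonally to `ξ` turns `𝓕 χ_W` into the integral `∫₀^π sin^n θ exp(it cos θ)
dθ` with `n = d₂`, which is `O(t^{-(n+1)/2})` by integration by parts. Hence balls are Fourier
smooth with exponent `1`, and the second statement is a case of the first estimate. -/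

namespace CutProject

/-! ### Parseval's identity for a lattice -/

/-- Parseval's identity for bounded functions on the unit cube. -/
theorem hasSum_sq_integral_unitCube {ι : Type*} [Fintype ι] {H : (ι → ℝ) → ℂ} (hm : Measurable H)
    {M : ℝ} (hM : ∀ x : ι → ℝ, (∀ i, x i ∈ Set.Ioc (0 : ℝ) 1) → ‖H x‖ ≤ M) :
    HasSum (fun n : ι → ℤ => ‖∫ x in {x : ι → ℝ | ∀ i, x i ∈ Set.Ioc (0 : ℝ) 1},
        Complex.exp (-(2 * Real.pi * Complex.I * ∑ i, (n i : ℂ) * (x i : ℂ))) * H x‖ ^ 2)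
      (∫ x in {x : ι → ℝ | ∀ i, x i ∈ Set.Ioc (0 : ℝ) 1}, ‖H x‖ ^ 2) := by
  set E := UnitAddTorus.measurableEquivPiIoc (fun _ : ι => (0 : ℝ)) with hE
  set g : UnitAddTorus ι → ℂ := fun t => H (E t).1 with hgdef
  have hbox : {x : ι → ℝ | ∀ i, x i ∈ Set.Ioc (0 : ℝ) 1} =
      {x : ι → ℝ | ∀ i, x i ∈ Set.Ioc (0 : ℝ) (0 + 1)} := by simp
  have hboxm : MeasurableSet {x : ι → ℝ | ∀ i, x i ∈ Set.Ioc (0 : ℝ) 1} :=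
    MeasurableSet.univ_pi' fun _ => measurableSet_Ioc
  have hgm : Measurable g := hm.comp (measurable_subtype_coe.comp E.measurable)
  have hgx : ∀ x : ι → ℝ, (∀ i, x i ∈ Set.Ioc (0 : ℝ) 1) →
      g (fun i => (x i : UnitAddCircle)) = H x := by
    intro x hx
    have hx' : ∀ i, x i ∈ Set.Ioc (0 : ℝ) (0 + 1) := by simpa using hx
    have : E (fun i => (x i : UnitAddCircle)) = ⟨x, hx'⟩ := by
      rw [← E.apply_symm_apply ⟨x, hx'⟩]
      rfl
    simp only [hgdef, this]
  have hg : MemLp g 2 (Measure.pi fun _ : ι => (AddCircle.haarAddCircle : Measure UnitAddCircle)) :=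
    MemLp.of_bound hgm.aestronglyMeasurable M
      (Eventually.of_forall fun t => hM _ (by simpa using (E t).2))
  have h := UnitAddTorus.hasSum_sq_mFourierCoeff (hg.toLp g)
  have h1 : ∫ t, ‖hg.toLp g t‖ ^ 2 ∂(Measure.pi fun _ : ι =>
      (AddCircle.haarAddCircle : Measure UnitAddCircle)) =
      ∫ x in {x : ι → ℝ | ∀ i, x i ∈ Set.Ioc (0 : ℝ) 1}, ‖H x‖ ^ 2 := by
    rw [integral_congr_ae (g := fun t => ‖g t‖ ^ 2)
      (by filter_upwards [hg.coeFn_toLp] with t ht using by rw [ht])]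
    refine (UnitAddTorus.integral_preimage (fun t => ‖g t‖ ^ 2) (fun _ => 0)).trans ?_
    rw [← hbox]
    exact setIntegral_congr_fun hboxm fun x hx => by simp only [hgx x hx]
  have h2 : ∀ n : ι → ℤ, UnitAddTorus.mFourierCoeff (hg.toLp g) n =
      ∫ x in {x : ι → ℝ | ∀ i, x i ∈ Set.Ioc (0 : ℝ) 1},
        Complex.exp (-(2 * Real.pi * Complex.I * ∑ i, (n i : ℂ) * (x i : ℂ))) * H x := by
    intro n
    have : UnitAddTorus.mFourierCoeff (hg.toLp g) n = UnitAddTorus.mFourierCoeff g n := by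
      refine integral_congr_ae ?_
      filter_upwards [hg.coeFn_toLp] with t ht using by rw [ht]
    rw [this, UnitAddTorus.mFourierCoeff_eq_integral g n (fun _ => 0), ← hbox]
    refine setIntegral_congr_fun hboxm fun x hx => ?_
    simp only [hgx x hx, smul_eq_mul]
    congr 1
    simp only [UnitAddTorus.mFourier, ContinuousMap.coe_mk, fourier_coe_apply, ← Complex.exp_sum]
    congr 1
    rw [Finset.mul_sum, ← Finset.sum_neg_distrib]
    refine Finset.sum_congr rfl fun i _ => ?_
    simp
    ring
  simp only [h2] at h
  rw [← h1]
  exact h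

/-- The coordinates with respect to a basis map the uniform probability measure on the
fundamental parallelotope to the uniform measure on the unit cube. -/
theorem map_equivFun_cond_fundamentalDomain {V ι : Type*} [NormedAddCommGroup V] [NormedSpace ℝ V]
    [MeasurableSpace V] [BorelSpace V] [FiniteDimensional ℝ V] [Fintype ι]
    (μ : Measure V) [μ.IsAddHaarMeasure] (b : Module.Basis ι ℝ V) :
    (ProbabilityTheory.cond μ (ZSpan.fundamentalDomain b)).map b.equivFun =
      (volume : Measure (ι → ℝ)).restrict {x | ∀ i, x i ∈ Set.Ioc (0 : ℝ) 1} := by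
  set L : V ≃L[ℝ] (ι → ℝ) := b.equivFun.toContinuousLinearEquiv with hL
  set F := ZSpan.fundamentalDomain b
  set Q : Set (ι → ℝ) := Set.univ.pi fun _ => Set.Ico (0 : ℝ) 1 with hQ
  have hFm : MeasurableSet F := ZSpan.fundamentalDomain_measurableSet b
  have hQm : MeasurableSet Q := MeasurableSet.univ_pi fun _ => measurableSet_Ico
  have hpre : F = L ⁻¹' Q := by
    ext v
    simp [F, ZSpan.mem_fundamentalDomain, hQ, hL]
  have hLm : Measurable L := L.continuous.measurable
  have hhaar : (μ.map L).IsAddHaarMeasure := L.isAddHaarMeasure_map μ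
  have hc := Measure.isAddLeftInvariant_eq_smul (μ.map L) (volume : Measure (ι → ℝ))
  set c := Measure.addHaarScalarFactor (μ.map L) (volume : Measure (ι → ℝ))
  have hQ1 : volume Q = 1 := by simp [hQ, Real.volume_pi_Ico]
  have hF0 : μ F ≠ 0 := ZSpan.measure_fundamentalDomain_ne_zero b
  have hFt : μ F ≠ ∞ := (ZSpan.fundamentalDomain_isBounded b).measure_lt_top.ne
  -- The Haar scaling factor is the volume of the parallelotope, so conditioning on `F` cancels it
  -- exactly.
  have hFc : μ F = c := by
    rw [hpre, ← Measure.map_apply hLm hQm, hc, Measure.smul_apply, hQ1]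
    simp [ENNReal.smul_def]
  -- The fundamental domain is half-open at `1`, the cube used for the torus is half-open at `0`;
  -- both agree with the closed cube up to a null set.
  have hQae : Q =ᵐ[volume] {x : ι → ℝ | ∀ i, x i ∈ Set.Ioc (0 : ℝ) 1} := by
    have h1 : Q =ᵐ[volume] Set.Icc (fun _ => (0 : ℝ)) (fun _ => 1) := Measure.univ_pi_Ico_ae_eq_Icc
    have h2 : (Set.univ.pi fun _ : ι => Set.Ioc (0 : ℝ) 1) =ᵐ[volume]
      Set.Icc (fun _ => (0 : ℝ)) (fun _ => 1) := Measure.univ_pi_Ioc_ae_eq_Icc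
    have h3 : (Set.univ.pi fun _ : ι => Set.Ioc (0 : ℝ) 1) =
        {x : ι → ℝ | ∀ i, x i ∈ Set.Ioc (0 : ℝ) 1} := by ext; simp
    rw [h3] at h2
    exact h1.trans h2.symm
  rw [← Measure.restrict_congr_set hQae]
  change (ProbabilityTheory.cond μ F).map L = _
  rw [ProbabilityTheory.cond, Measure.map_smul, hFc]
  conv_lhs => rw [hpre]
  rw [← Measure.restrict_map hLm hQm, hc, Measure.restrict_smul]
  change (c : ℝ≥0∞)⁻¹ • ((c : ℝ≥0∞) • volume.restrict Q) = _
  rw [smul_smul, ENNReal.inv_mul_cancel, one_smul]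
  · rw [← hFc]; exact hF0
  · exact ENNReal.coe_ne_top

/-- Parseval's identity for bounded functions on a fundamental parallelotope. -/
theorem hasSum_sq_integral_fundamentalDomain {V ι : Type*} [NormedAddCommGroup V] [NormedSpace ℝ V]
    [MeasurableSpace V] [BorelSpace V] [FiniteDimensional ℝ V] [Fintype ι]
    (μ : Measure V) [μ.IsAddHaarMeasure] (b : Module.Basis ι ℝ V) {G : V → ℂ} (hG : Measurable G)
    {M : ℝ} (hM : ∀ v : V, (∀ i, b.repr v i ∈ Set.Icc (0 : ℝ) 1) → ‖G v‖ ≤ M) :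
    HasSum (fun n : ι → ℤ => ‖∫ v, Complex.exp (-(2 * Real.pi * Complex.I *
        ∑ i, (n i : ℂ) * (b.repr v i : ℂ))) * G v
          ∂(ProbabilityTheory.cond μ (ZSpan.fundamentalDomain b))‖ ^ 2)
      (∫ v, ‖G v‖ ^ 2 ∂(ProbabilityTheory.cond μ (ZSpan.fundamentalDomain b))) := by
  set L : V ≃L[ℝ] (ι → ℝ) := b.equivFun.toContinuousLinearEquiv with hL
  have hLs : ∀ v i, L v i = b.repr v i := fun v i => rfl
  have hmap := map_equivFun_cond_fundamentalDomain μ b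
  have key : ∀ {E : Type} [NormedAddCommGroup E] [NormedSpace ℝ E] (f : (ι → ℝ) → E),
      ∫ v, f (L v) ∂(ProbabilityTheory.cond μ (ZSpan.fundamentalDomain b)) =
        ∫ x in {x : ι → ℝ | ∀ i, x i ∈ Set.Ioc (0 : ℝ) 1}, f x := by
    intro E _ _ f
    rw [← hmap]
    exact (L.toHomeomorph.measurableEmbedding.integral_map f).symm
  -- The bound on `G` is assumed on the closed parallelotope because the cube contains faces that
  -- the fundamental domain omits.
  have h := hasSum_sq_integral_unitCube (H := fun x => G (L.symm x))
    (hG.comp L.symm.continuous.measurable) (M := M) (fun x hx => hM _ fun i => by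
      rw [← hLs, L.apply_symm_apply]
      exact Set.Ioc_subset_Icc_self (hx i))
  simp only [← key, L.symm_apply_apply, hLs] at h
  exact h

/-! ### Periodization over a lattice -/

section Periodization

variable {V : Type*} [NormedAddCommGroup V] [NormedSpace ℝ V] [FiniteDimensional ℝ V]
  (Γ : Submodule ℤ V)

/-- If `γ + v ∈ K` with `v ∈ A`, then `γ` lies in the bounded set `K - A`, which meets the discrete
group `Γ` in finitely many points. Periodizations are thus finite sums, uniformly on bounded sets.
-/
theorem exists_finset_forall_notMem [DiscreteTopology Γ] {A K : Set V}
    (hA : Bornology.IsBounded A) (hK : Bornology.IsBounded K) :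
    ∃ N : Finset Γ, ∀ v ∈ A, ∀ γ : Γ, γ ∉ N → (γ : V) + v ∉ K := by
  have := FiniteDimensional.proper_real V
  have hb : Bornology.IsBounded (K - A) := hK.sub hA
  obtain ⟨R, hR⟩ := hb.subset_closedBall 0
  have ht := AddSubgroup.tendsto_coe_cofinite_of_discrete Γ.toAddSubgroup
    (isDiscrete_iff_discreteTopology.mpr ‹DiscreteTopology Γ›)
  have h := ht (isCompact_closedBall (0 : V) R).compl_mem_cocompact
  have hfin : {γ : Γ | (γ : V) ∈ closedBall (0 : V) R}.Finite := by
    rw [mem_map, mem_cofinite] at h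
    exact h.subset fun γ hγ h' => h' hγ
  refine ⟨hfin.toFinset, fun v hv γ hγ hK' => hγ ?_⟩
  rw [Set.Finite.mem_toFinset]
  exact hR ⟨_, hK', v, hv, by simp⟩

variable [MeasurableSpace V] [BorelSpace V] [DiscreteTopology Γ] [IsZLattice ℝ Γ]

/-- Unfolding: the integral over `V` splits over the translates of `F`, the periodic factor `e` is
the same on each, and only finitely many translates meet the support of `Φ`, so sum and integral
commute. -/
theorem integral_fundamentalDomain_mul_tsum {μ : Measure V} [μ.IsAddHaarMeasure] {F : Set V}
    (hF : IsAddFundamentalDomain Γ F μ) (hFb : Bornology.IsBounded F) (hFm : MeasurableSet F)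
    {Φ e : V → ℂ}
    {K : Set V} (hK : Bornology.IsBounded K) (hΦK : ∀ v ∉ K, Φ v = 0) (hΦ : Integrable Φ μ)
    (he : Continuous e) (he1 : ∀ v, ‖e v‖ ≤ 1) (heΓ : ∀ γ ∈ Γ, ∀ v, e (γ + v) = e v) :
    ∫ v in F, e v * ∑' γ : Γ, Φ (γ + v) ∂μ = ∫ v, e v * Φ v ∂μ := by
  have : VAddInvariantMeasure Γ V μ :=
    ⟨fun γ s _ => measure_preimage_add μ (γ : V) s⟩
  obtain ⟨N, hN⟩ := exists_finset_forall_notMem Γ hFb hK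
  have hint : Integrable (fun v => e v * Φ v) μ :=
    hΦ.bdd_mul he.aestronglyMeasurable (Eventually.of_forall he1)
  rw [hF.integral_eq_tsum'' _ hint]
  have h1 : ∀ γ : Γ, ∫ v in F, e (γ +ᵥ v) * Φ (γ +ᵥ v) ∂μ = ∫ v in F, e v * Φ (γ + v) ∂μ :=
    fun γ => integral_congr_ae (Eventually.of_forall fun v => by
      change e ((γ : V) + v) * Φ ((γ : V) + v) = _
      rw [heΓ _ γ.2])
  simp only [h1]
  rw [tsum_eq_sum (s := N) fun γ hγ => setIntegral_eq_zero_of_forall_eq_zero fun v hv => by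
    rw [hΦK _ (hN v hv γ hγ), mul_zero], ← integral_finsetSum]
  · refine setIntegral_congr_fun hFm fun v hv => ?_
    rw [tsum_eq_sum (s := N) fun γ hγ => hΦK _ (hN v hv γ hγ), Finset.mul_sum]
  · intro γ _
    exact ((hΦ.comp_add_left (γ : V)).bdd_mul he.aestronglyMeasurable
      (Eventually.of_forall he1)).integrableOn

end Periodization

/-! ### Characters and the dual lattice -/

section Dual

variable {d₁ d₂ : ℕ} (Γ : Submodule ℤ (Euc d₁ × Euc d₂))

/-- The standard inner product on `ℝ^{d₁} × ℝ^{d₂}`. -/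
noncomputable def pairing (ξ v : Euc d₁ × Euc d₂) : ℝ := inner ℝ ξ.1 v.1 + inner ℝ ξ.2 v.2

theorem pairing_add (ξ v w : Euc d₁ × Euc d₂) :
    pairing ξ (v + w) = pairing ξ v + pairing ξ w := by
  simp [pairing, inner_add_right]
  ring

/-- Riesz representation is applied on each factor, since the product carries the sup norm rather
than an inner product norm. -/
theorem exists_pairing_eq (l : (Euc d₁ × Euc d₂) →ₗ[ℝ] ℝ) :
    ∃ ξ, ∀ v, pairing ξ v = l v := by
  let l₁ := (l ∘ₗ LinearMap.inl ℝ _ _).toContinuousLinearMap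
  let l₂ := (l ∘ₗ LinearMap.inr ℝ _ _).toContinuousLinearMap
  refine ⟨((InnerProductSpace.toDual ℝ _).symm l₁, (InnerProductSpace.toDual ℝ _).symm l₂),
    fun v => ?_⟩
  simp only [pairing, InnerProductSpace.toDual_symm_apply]
  change l (v.1, 0) + l (0, v.2) = l v
  rw [← map_add]
  simp

theorem pairing_injective {ξ ξ' : Euc d₁ × Euc d₂} (h : ∀ v, pairing ξ v = pairing ξ' v) :
    ξ = ξ' := by
  refine Prod.ext (ext_inner_right ℝ fun v => ?_) (ext_inner_right ℝ fun v => ?_)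
  · simpa [pairing] using h (v, 0)
  · simpa [pairing] using h (0, v)

theorem pairing_eq_sum {ι : Type*} [Fintype ι] (b : Module.Basis ι ℝ (Euc d₁ × Euc d₂))
    (ξ v : Euc d₁ × Euc d₂) : pairing ξ v = ∑ i, pairing ξ (b i) * b.repr v i := by
  let l : (Euc d₁ × Euc d₂) →ₗ[ℝ] ℝ :=
    { toFun := pairing ξ
      map_add' := pairing_add ξ
      map_smul' := fun c v => by simp [pairing, inner_smul_right, mul_add] }
  change l v = ∑ i, l (b i) * b.repr v i
  conv_lhs => rw [← b.sum_repr v, map_sum]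
  exact Finset.sum_congr rfl fun i _ => by rw [map_smul, smul_eq_mul, mul_comm]

/-- This is the dual basis: an element of `Γ^⊥` is determined by its pairings with a `ℤ`-basis of
`Γ`, and these can be arbitrary integers. It matches the frequencies `n` of the unit cube with the
points of `Γ^⊥`. -/
theorem exists_equiv_dualLattice [DiscreteTopology Γ] [IsZLattice ℝ Γ] {ι : Type*} [Fintype ι]
    (bZ : Module.Basis ι ℤ Γ) :
    ∃ e : (ι → ℤ) ≃ dualLattice Γ, ∀ n v,
      pairing (e n : Euc d₁ × Euc d₂) v = ∑ i, (n i : ℝ) * (bZ.ofZLatticeBasis ℝ Γ).repr v i := by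
  set b := bZ.ofZLatticeBasis ℝ Γ with hb
  have hex : ∀ n : ι → ℤ, ∃ ξ : Euc d₁ × Euc d₂, ∀ v,
      pairing ξ v = ∑ i, (n i : ℝ) * b.repr v i := by
    intro n
    obtain ⟨ξ, hξ⟩ := exists_pairing_eq (∑ i, (n i : ℝ) • b.coord i)
    exact ⟨ξ, fun v => by rw [hξ]; simp⟩
  choose ξ hξ using hex
  have hmem : ∀ n, ξ n ∈ dualLattice Γ := by
    intro n γ hγ
    refine ⟨∑ i, n i * bZ.repr ⟨γ, hγ⟩ i, ?_⟩
    have := hξ n γ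
    simp only [pairing] at this
    rw [this]
    push_cast
    refine Finset.sum_congr rfl fun i _ => ?_
    rw [← bZ.ofZLatticeBasis_repr_apply ℝ Γ ⟨γ, hγ⟩ i]
  have hbi : ∀ n i, pairing (ξ n) (b i) = n i := by
    classical
    intro n i
    rw [hξ]
    simp [Finsupp.single_apply]
  refine ⟨Equiv.ofBijective (fun n => ⟨ξ n, hmem n⟩) ⟨fun n m h => ?_, fun ζ => ?_⟩, hξ⟩
  · have h' : ξ n = ξ m := congrArg Subtype.val h
    funext i
    have := hbi n i
    rw [h', hbi] at this
    exact_mod_cast this.symm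
  · have hbΓ : ∀ i, b i ∈ Γ := fun i => by
      rw [hb, bZ.ofZLatticeBasis_apply ℝ Γ]
      exact (bZ i).2
    choose n hn using fun i => ζ.2 (b i) (hbΓ i)
    refine ⟨n, Subtype.ext (pairing_injective fun v => ?_)⟩
    rw [pairing_eq_sum b, pairing_eq_sum b]
    refine Finset.sum_congr rfl fun i _ => ?_
    rw [hbi, ← hn]
    rfl

end Dual

/-! ### The process as a sum over the lattice -/

section LatticeSum

variable {d₁ d₂ : ℕ} {Γ : Submodule ℤ (Euc d₁ × Euc d₂)}

/-- The random set has no multiplicities, whereas the sum over `Γ` could count a point repeatedly.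
Injectivity of the first projection on `Γ` excludes this. -/
theorem cutProjectProcess_mk (hΓ : IsCutProjectLattice Γ) (W : Set (Euc d₂))
    (v : Euc d₁ × Euc d₂) :
    cutProjectProcess Γ W (QuotientAddGroup.mk v) =
      Measure.sum fun γ : Γ =>
        W.indicator (fun _ => (1 : ℝ≥0∞)) (γ + v).2 • Measure.dirac (γ + v : Euc d₁ × Euc d₂).1 := by
  set A : Set Γ := {γ | ((γ : Euc d₁ × Euc d₂) + v).2 ∈ W} with hA
  have hmem : ∀ γ : A, ((γ : Γ) + v : Euc d₁ × Euc d₂).1 ∈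
      randomSet Γ W (QuotientAddGroup.mk v) := by
    rintro ⟨γ, hγ⟩
    refine ⟨((γ : Euc d₁ × Euc d₂) + v).2, hγ, ?_⟩
    refine (QuotientAddGroup.eq.2 ?_).symm
    simp only [Prod.mk.eta]
    rw [add_comm (γ : Euc d₁ × Euc d₂) v, neg_add_cancel_left]
    exact γ.2
  have hbij : Function.Bijective fun γ : A =>
      (⟨_, hmem γ⟩ : randomSet Γ W (QuotientAddGroup.mk v)) := by
    constructor
    · intro γ γ' h
      have h1 := congrArg Subtype.val h
      simp only [Prod.fst_add, add_left_inj] at h1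
      exact Subtype.ext (Subtype.ext (hΓ.injOn_fst γ.1.2 γ'.1.2 h1))
    · rintro ⟨g, k, hk, hq⟩
      have hq' := QuotientAddGroup.eq.1 hq.symm
      refine ⟨⟨⟨_, hq'⟩, ?_⟩, ?_⟩
      · simp only [hA, Set.mem_ofPred_eq, add_comm _ v, add_neg_cancel_left]
        exact hk
      · refine Subtype.ext ?_
        simp only [add_comm _ v, add_neg_cancel_left]
  ext B hB
  rw [cutProjectProcess, Measure.sum_apply _ hB, Measure.sum_apply _ hB,
    ← (Equiv.ofBijective _ hbij).tsum_eq]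
  simp only [Equiv.ofBijective_apply, Measure.smul_apply, smul_eq_mul]
  rw [tsum_subtype A fun γ : Γ => Measure.dirac (γ + v : Euc d₁ × Euc d₂).1 B]
  refine tsum_congr fun γ => ?_
  by_cases h : ((γ : Euc d₁ × Euc d₂) + v).2 ∈ W
  · rw [Set.indicator_of_mem h, Set.indicator_of_mem (show γ ∈ A from h), one_mul]
  · rw [Set.indicator_of_notMem h, Set.indicator_of_notMem (show γ ∉ A from h), zero_mul]

/-- The right-hand side is the periodization of `f ⊗ χ_W`, the function to which Parseval's identity
is applied. -/
theorem linearStatistic_mk [Countable Γ] (hΓ : IsCutProjectLattice Γ) (W : Set (Euc d₂)) (f : Euc d₁ → ℂ)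
    (v : Euc d₁ × Euc d₂) :
    linearStatistic (cutProjectProcess Γ W) f (QuotientAddGroup.mk v) =
      ∑' γ : Γ, f (γ + v : Euc d₁ × Euc d₂).1 *
        W.indicator (fun _ => (1 : ℂ)) (γ + v : Euc d₁ × Euc d₂).2 := by
  rw [linearStatistic, cutProjectProcess_mk hΓ, integral_sum_dirac]
  · refine tsum_congr fun γ => ?_
    by_cases h : ((γ : Euc d₁ × Euc d₂) + v).2 ∈ W
    · rw [Set.indicator_of_mem h, Set.indicator_of_mem h]
      simp
    · rw [Set.indicator_of_notMem h, Set.indicator_of_notMem h]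
      simp
  · intro γ
    have h : W.indicator (fun _ => (1 : ℝ≥0∞)) ((γ : Euc d₁ × Euc d₂) + v).2 ≤ 1 :=
      Set.indicator_le_self' (f := fun _ => (1 : ℝ≥0∞)) (by simp) _
    exact (h.trans_lt ENNReal.one_lt_top).ne

theorem measurable_cutProjectProcess [DiscreteTopology Γ] [IsZLattice ℝ Γ]
    (hΓ : IsCutProjectLattice Γ) {W : Set (Euc d₂)} (hW : MeasurableSet W) :
    Measurable (cutProjectProcess Γ W) := by
  refine Measure.measurable_of_measurable_coe _ fun B hB => ?_
  refine measurable_from_quotient.2 ?_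
  have : ∀ v : Euc d₁ × Euc d₂, cutProjectProcess Γ W (QuotientAddGroup.mk v) B =
      ∑' γ : Γ, W.indicator (fun _ => (1 : ℝ≥0∞)) (γ + v : Euc d₁ × Euc d₂).2 *
        B.indicator 1 (γ + v : Euc d₁ × Euc d₂).1 := by
    intro v
    rw [cutProjectProcess_mk hΓ, Measure.sum_apply _ hB]
    refine tsum_congr fun γ => ?_
    rw [Measure.smul_apply, Measure.dirac_apply' _ hB, smul_eq_mul]
  change Measurable fun v : Euc d₁ × Euc d₂ =>
    cutProjectProcess Γ W (QuotientAddGroup.mk v) B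
  simp only [this]
  refine Measurable.tsum fun γ => Measurable.mul ?_ ?_
  · exact (measurable_const.indicator hW).comp (measurable_snd.comp (measurable_const_add _))
  · exact (measurable_one.indicator hB).comp (measurable_fst.comp (measurable_const_add _))

theorem isLocallySquareIntegrable_cutProjectProcess [DiscreteTopology Γ] [IsZLattice ℝ Γ]
    (hΓ : IsCutProjectLattice Γ) {W : Set (Euc d₂)} (hW : MeasurableSet W)
    (hWb : Bornology.IsBounded W) :
    IsLocallySquareIntegrable (torusMeasure Γ) (cutProjectProcess Γ W) where
  measurable := measurable_cutProjectProcess hΓ hW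
  lintegral_sq_lt_top B hB hBb := by
    have hm : Measurable fun ω => cutProjectProcess Γ W ω B ^ 2 :=
      ((Measure.measurable_coe hB).comp (measurable_cutProjectProcess hΓ hW)).pow_const 2
    have hmk : Measurable (QuotientAddGroup.mk : Euc d₁ × Euc d₂ → Torus Γ) := measurable_quot_mk
    have hFb : Bornology.IsBounded (fundDomain Γ) := ZSpan.fundamentalDomain_isBounded _
    obtain ⟨N, hN⟩ := exists_finset_forall_notMem Γ hFb (hBb.prod hWb)
    -- Only the translates in `N` can land in `B × W`, and each contributes mass at most `1`.
    have hle : ∀ v ∈ fundDomain Γ,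
        cutProjectProcess Γ W (QuotientAddGroup.mk v) B ≤ N.card := by
      intro v hv
      rw [cutProjectProcess_mk hΓ, Measure.sum_apply _ hB, tsum_eq_sum (s := N)]
      · refine (Finset.sum_le_card_nsmul N _ 1 fun γ _ => ?_).trans (by simp)
        rw [Measure.smul_apply, Measure.dirac_apply' _ hB, smul_eq_mul]
        refine mul_le_one' ?_ ?_ <;> exact Set.indicator_le_self' (by simp) _
      · intro γ hγ
        have := hN v hv γ hγ
        rw [Measure.smul_apply, Measure.dirac_apply' _ hB, smul_eq_mul, mul_eq_zero]
        by_contra! hne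
        exact this ⟨Set.mem_of_indicator_ne_zero hne.2, Set.mem_of_indicator_ne_zero hne.1⟩
    rw [torusMeasure, lintegral_map hm hmk]
    have hc : ∀ᵐ v ∂(ProbabilityTheory.cond volume (fundDomain Γ)), v ∈ fundDomain Γ :=
      ProbabilityTheory.ae_cond_mem (measurableSet_fundDomain Γ)
    have hP : IsProbabilityMeasure (ProbabilityTheory.cond
        (volume : Measure (Euc d₁ × Euc d₂)) (fundDomain Γ)) :=
      ProbabilityTheory.cond_isProbabilityMeasure_of_finite
        (ZSpan.measure_fundamentalDomain_ne_zero _) hFb.measure_lt_top.ne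
    refine (lintegral_mono_ae (g := fun _ => (N.card : ℝ≥0∞) ^ 2) ?_).trans_lt ?_
    · filter_upwards [hc] with v hv using by
        have := hle v hv
        gcongr
    · rw [lintegral_const, measure_univ, mul_one]
      exact ENNReal.pow_lt_top (by simp)

end LatticeSum

/-! ### The centered diffraction of a cut-and-project process -/

section Diffraction

variable {d₁ d₂ : ℕ} {Γ : Submodule ℤ (Euc d₁ × Euc d₂)}

theorem integral_exp_pairing_mul (f : Euc d₁ → ℂ) (g : Euc d₂ → ℂ) (ξ : Euc d₁ × Euc d₂) :
    ∫ v : Euc d₁ × Euc d₂, Complex.exp (-(2 * Real.pi * Complex.I * (pairing ξ v : ℂ))) *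
      (f v.1 * g v.2) = 𝓕 f ξ.1 * 𝓕 g ξ.2 := by
  rw [Real.fourier_eq', Real.fourier_eq', ← integral_prod_mul]
  refine integral_congr_ae (Eventually.of_forall fun v => ?_)
  simp only [pairing, smul_eq_mul]
  have : Complex.exp (-(2 * Real.pi * Complex.I *
      ((inner ℝ ξ.1 v.1 + inner ℝ ξ.2 v.2 : ℝ) : ℂ))) =
      Complex.exp ((-2 * Real.pi * inner ℝ v.1 ξ.1 : ℝ) * Complex.I) *
      Complex.exp ((-2 * Real.pi * inner ℝ v.2 ξ.2 : ℝ) * Complex.I) := by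
    rw [← Complex.exp_add, real_inner_comm v.1, real_inner_comm v.2]
    congr 1
    push_cast
    ring
  rw [this]
  ring

theorem exp_pairing_add {ξ : Euc d₁ × Euc d₂} (hξ : ξ ∈ dualLattice Γ) {γ : Euc d₁ × Euc d₂}
    (hγ : γ ∈ Γ) (v : Euc d₁ × Euc d₂) :
    Complex.exp (-(2 * Real.pi * Complex.I * (pairing ξ (γ + v) : ℂ))) =
      Complex.exp (-(2 * Real.pi * Complex.I * (pairing ξ v : ℂ))) := by
  obtain ⟨n, hn⟩ := hξ γ hγ
  have hn' : pairing ξ γ = n := hn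
  rw [pairing_add, hn']
  refine Complex.exp_eq_exp_iff_exists_int.2 ⟨-n, ?_⟩
  push_cast
  ring

theorem integral_norm_sub_integral_sq {Ω : Type*} [MeasurableSpace Ω] {P : Measure Ω}
    [IsProbabilityMeasure P] {G : Ω → ℂ} (hG : MemLp G 2 P) :
    ∫ ω, ‖G ω - ∫ ω', G ω' ∂P‖ ^ 2 ∂P = ∫ ω, ‖G ω‖ ^ 2 ∂P - ‖∫ ω, G ω ∂P‖ ^ 2 := by
  have h1 : Integrable G P := hG.integrable (by norm_num)
  set m := ∫ ω, G ω ∂P with hm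
  have h2 : Integrable (fun ω => ‖G ω‖ ^ 2) P := hG.integrable_norm_pow (by norm_num)
  have h3 : Integrable (fun ω => 2 * inner ℝ m (G ω)) P := (h1.const_inner m).const_mul 2
  have : ∀ ω, ‖G ω - m‖ ^ 2 = ‖G ω‖ ^ 2 - 2 * inner ℝ m (G ω) + ‖m‖ ^ 2 := fun ω => by
    rw [norm_sub_sq_real, real_inner_comm]
  simp only [this]
  have h4 : Integrable (fun ω => ‖G ω‖ ^ 2 - 2 * inner ℝ m (G ω)) P := h2.sub h3
  rw [integral_add h4 (integrable_const _), integral_sub h2 h3, integral_const_mul,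
    integral_inner h1 m, ← hm, real_inner_self_eq_norm_sq]
  simp
  ring

variable [DiscreteTopology Γ] [IsZLattice ℝ Γ]

/-- The weight `covol(Γ)⁻² |𝓕 χ_W (ξ₂)|²` of the diffraction at `ξ₁`, for `0 ≠ ξ ∈ Γ^⊥`. -/
noncomputable def diffractionWeight (Γ : Submodule ℤ (Euc d₁ × Euc d₂)) [DiscreteTopology Γ]
    [IsZLattice ℝ Γ] (W : Set (Euc d₂)) (ξ : Euc d₁ × Euc d₂) : ℝ :=
  open scoped Classical in
  if ξ = 0 then 0 else
    ((volume (fundDomain Γ)).toReal⁻¹ * ‖𝓕 (W.indicator (fun _ => (1 : ℂ))) ξ.2‖) ^ 2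

/-- The pure point measure `∑ diffractionWeight ξ • δ_{ξ₁}` over `ξ ∈ Γ^⊥`. -/
noncomputable def diffractionMeasure (Γ : Submodule ℤ (Euc d₁ × Euc d₂)) [DiscreteTopology Γ]
    [IsZLattice ℝ Γ] (W : Set (Euc d₂)) : Measure (Euc d₁) :=
  Measure.sum fun ξ : dualLattice Γ =>
    ENNReal.ofReal (diffractionWeight Γ W ξ) • Measure.dirac (ξ : Euc d₁ × Euc d₂).1

theorem lintegral_diffractionMeasure (W : Set (Euc d₂)) {g : Euc d₁ → ℝ≥0∞} :
    ∫⁻ ξ, g ξ ∂(diffractionMeasure Γ W) =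
      ∑' ξ : dualLattice Γ, ENNReal.ofReal (diffractionWeight Γ W ξ) *
        g (ξ : Euc d₁ × Euc d₂).1 := by
  simp [diffractionMeasure, lintegral_sum_measure, lintegral_smul_measure]

/-- Parseval's identity for the periodization `G` of `f ⊗ χ_W`: unfolding computes its coefficients,
and subtracting the mean deletes the coefficient at `ξ = 0`, which is why `diffractionWeight`
vanishes there. -/
theorem complexVariance_linearStatistic (hΓ : IsCutProjectLattice Γ) {W : Set (Euc d₂)}
    (hW : MeasurableSet W) (hWb : Bornology.IsBounded W) {f : Euc d₁ → ℂ} (hf : Continuous f)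
    (hfc : HasCompactSupport f) :
    complexVariance (torusMeasure Γ) (linearStatistic (cutProjectProcess Γ W) f) =
      ∫⁻ ξ, ‖𝓕 f ξ‖ₑ ^ 2 ∂(diffractionMeasure Γ W) := by
  classical
  set bZ := Module.Free.chooseBasis ℤ Γ
  set b := bZ.ofZLatticeBasis ℝ Γ with hb
  set F := fundDomain Γ with hF
  set κ := (volume F).toReal with hκ
  set P := ProbabilityTheory.cond (volume : Measure (Euc d₁ × Euc d₂)) F with hP
  set χ : Euc d₂ → ℂ := W.indicator fun _ => (1 : ℂ) with hχ
  set Φ : Euc d₁ × Euc d₂ → ℂ := fun z => f z.1 * χ z.2 with hΦ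
  set G : Euc d₁ × Euc d₂ → ℂ := fun v => ∑' γ : Γ, Φ (γ + v) with hG
  have hFm : MeasurableSet F := measurableSet_fundDomain Γ
  have hFb : Bornology.IsBounded F := ZSpan.fundamentalDomain_isBounded _
  have hPp : IsProbabilityMeasure P := ProbabilityTheory.cond_isProbabilityMeasure_of_finite
    (ZSpan.measure_fundamentalDomain_ne_zero _) hFb.measure_lt_top.ne
  have hmk : Measurable (QuotientAddGroup.mk : Euc d₁ × Euc d₂ → Torus Γ) := measurable_quot_mk
  have hχm : Measurable χ := measurable_const.indicator hW
  have hΦm : Measurable Φ :=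
    (hf.measurable.comp measurable_fst).mul (hχm.comp measurable_snd)
  have hGm : Measurable G := Measurable.tsum fun γ => hΦm.comp (measurable_const_add _)
  set K : Set (Euc d₁ × Euc d₂) := tsupport f ×ˢ W with hK
  have hKb : Bornology.IsBounded K := hfc.isCompact.isBounded.prod hWb
  have hΦK : ∀ v ∉ K, Φ v = 0 := by
    intro v hv
    by_contra hne
    obtain ⟨h1, h2⟩ := mul_ne_zero_iff.1 hne
    exact hv ⟨subset_tsupport f h1, Set.mem_of_indicator_ne_zero h2⟩
  have hΦi : Integrable Φ := by
    refine (hf.integrable_of_hasCompactSupport hfc).mul_prod ?_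
    exact (integrable_indicator_iff hW).2 (integrableOn_const hWb.measure_lt_top.ne)
  obtain ⟨M₀, hM₀⟩ := hf.bounded_above_of_compact_support hfc
  have hΦM : ∀ v, ‖Φ v‖ ≤ M₀ := fun v => by
    rw [norm_mul]
    refine (mul_le_mul (hM₀ _) (norm_indicator_le_norm_self _ _) (norm_nonneg _)
      ((norm_nonneg _).trans (hM₀ 0))).trans (by simp)
  set A : Set (Euc d₁ × Euc d₂) := {v | ∀ i, b.repr v i ∈ Set.Icc (0 : ℝ) 1} with hA
  have hAb : Bornology.IsBounded A := by
    have hc : IsCompact (b.equivFun.toContinuousLinearEquiv.symm ''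
        (Set.univ.pi fun _ => Set.Icc (0 : ℝ) 1)) :=
      (isCompact_univ_pi fun _ => isCompact_Icc).image (ContinuousLinearEquiv.continuous _)
    refine hc.isBounded.subset fun v hv => ⟨b.equivFun v, fun i _ => hv i, ?_⟩
    exact b.equivFun.symm_apply_apply v
  have hFA : F ⊆ A := fun v hv i => by
    have := (ZSpan.mem_fundamentalDomain b).1 hv i
    exact ⟨this.1, this.2.le⟩
  obtain ⟨N, hN⟩ := exists_finset_forall_notMem Γ hAb hKb
  have hGM : ∀ v ∈ A, ‖G v‖ ≤ N.card * M₀ := by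
    intro v hv
    simp only [hG]
    rw [tsum_eq_sum (s := N) fun γ hγ => hΦK _ (hN v hv γ hγ)]
    refine (norm_sum_le_of_le N fun γ _ => hΦM _).trans ?_
    simp
  have hPF : ∀ᵐ v ∂P, v ∈ F := ProbabilityTheory.ae_cond_mem hFm
  have hGL : MemLp G 2 P := MemLp.of_bound hGm.aestronglyMeasurable (N.card * M₀)
    (by filter_upwards [hPF] with v hv using hGM v (hFA hv))
  obtain ⟨e, he⟩ := exists_equiv_dualLattice Γ bZ
  -- The factor `κ⁻¹` comes from normalizing Lebesgue measure on `F` to a probability measure.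
  have hcoef : ∀ ξ ∈ dualLattice Γ,
      ∫ v, Complex.exp (-(2 * Real.pi * Complex.I * (pairing ξ v : ℂ))) * G v ∂P =
        (κ⁻¹ : ℝ) * (𝓕 f ξ.1 * 𝓕 χ ξ.2) := by
    intro ξ hξ
    rw [hP, ProbabilityTheory.cond, integral_smul_measure,
      integral_fundamentalDomain_mul_tsum Γ (isAddFundamentalDomain_fundDomain Γ) hFb hFm hKb hΦK
        hΦi, integral_exp_pairing_mul f χ ξ, ENNReal.toReal_inv]
    · rfl
    · unfold pairing
      fun_prop
    · intro v
      rw [Complex.norm_exp]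
      simp
    · exact fun γ hγ v => exp_pairing_add hξ hγ v
  have hsum : HasSum (fun ξ : dualLattice Γ =>
      ‖((κ⁻¹ : ℝ) : ℂ) * (𝓕 f (ξ : Euc d₁ × Euc d₂).1 * 𝓕 χ (ξ : Euc d₁ × Euc d₂).2)‖ ^ 2)
      (∫ v, ‖G v‖ ^ 2 ∂P) := by
    rw [← e.hasSum_iff]
    have h := hasSum_sq_integral_fundamentalDomain volume b hGm hGM
    refine h.congr_fun fun n => ?_
    simp only [Function.comp]
    rw [← hcoef _ (e n).2]
    simp only [he]
    push_cast
    rfl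
  have h0 : (0 : Euc d₁ × Euc d₂) ∈ dualLattice Γ := fun γ _ => ⟨0, by simp⟩
  have hmean : ∫ v, G v ∂P = (κ⁻¹ : ℝ) * (𝓕 f 0 * 𝓕 χ 0) := by
    refine Eq.trans ?_ (hcoef 0 h0)
    simp [pairing]
  have hsum' := hasSum_ite_sub_hasSum hsum ⟨0, h0⟩
  have hX : ∀ v, linearStatistic (cutProjectProcess Γ W) f (QuotientAddGroup.mk v) = G v :=
    linearStatistic_mk hΓ W f
  have hXm : Measurable (linearStatistic (cutProjectProcess Γ W) f) :=
    measurable_from_quotient.2 (by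
      change Measurable fun v : Euc d₁ × Euc d₂ =>
        linearStatistic (cutProjectProcess Γ W) f (QuotientAddGroup.mk v)
      simpa only [hX] using hGm)
  have hXmean : ∫ ω, linearStatistic (cutProjectProcess Γ W) f ω ∂(torusMeasure Γ) =
      ∫ v, G v ∂P := by
    rw [torusMeasure, integral_map hmk.aemeasurable hXm.aestronglyMeasurable]
    simp only [hX, ← hF, ← hP]
  rw [complexVariance, hXmean, torusMeasure,
    lintegral_map ((hXm.sub_const _).enorm.pow_const 2) hmk]
  simp only [hX, ← hF, ← hP]
  have hvar := integral_norm_sub_integral_sq hGL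
  have hL2 : Integrable (fun v => ‖G v - ∫ v', G v' ∂P‖ ^ 2) P :=
    (hGL.sub (memLp_const _)).integrable_norm_pow (by norm_num)
  have hlint : ∫⁻ v, ‖G v - ∫ v', G v' ∂P‖ₑ ^ 2 ∂P =
      ENNReal.ofReal (∫ v, ‖G v - ∫ v', G v' ∂P‖ ^ 2 ∂P) := by
    rw [ofReal_integral_eq_lintegral_ofReal hL2 (Eventually.of_forall fun _ => by positivity)]
    refine lintegral_congr fun v => ?_
    rw [ENNReal.ofReal_pow (norm_nonneg _), ofReal_norm]
  rw [hlint, hvar, hmean]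
  change ENNReal.ofReal (_ - ‖((κ⁻¹ : ℝ) : ℂ) *
    (𝓕 f (0 : Euc d₁ × Euc d₂).1 * 𝓕 χ (0 : Euc d₁ × Euc d₂).2)‖ ^ 2) = _
  rw [← hsum'.tsum_eq, ENNReal.ofReal_tsum_of_nonneg
    (fun ξ => by split_ifs <;> positivity) hsum'.summable, lintegral_diffractionMeasure]
  refine tsum_congr fun ξ => ?_
  unfold diffractionWeight
  by_cases hξ : (ξ : Euc d₁ × Euc d₂) = 0
  · rw [if_pos (Subtype.ext hξ), if_pos hξ]
    simp
  · rw [if_neg fun h => hξ (congrArg Subtype.val h), if_neg hξ, ← ofReal_norm,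
      ← ENNReal.ofReal_pow (norm_nonneg _), ← ENNReal.ofReal_mul (by positivity)]
    congr 1
    simp only [norm_mul, Complex.norm_real, Real.norm_eq_abs]
    rw [abs_of_nonneg (by positivity)]
    ring

theorem isCenteredDiffraction_diffractionMeasure (hΓ : IsCutProjectLattice Γ) {W : Set (Euc d₂)}
    (hW : MeasurableSet W) (hWb : Bornology.IsBounded W)
    (hfin : ∀ R : ℝ, 0 < R → diffractionMeasure Γ W (ball 0 R) < ∞) :
    IsCenteredDiffraction (torusMeasure Γ) (cutProjectProcess Γ W) (diffractionMeasure Γ W) where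
  isLocallyFinite := ⟨fun x => ⟨ball 0 (‖x‖ + 1), isOpen_ball.mem_nhds (by simp),
    hfin _ (by positivity)⟩⟩
  lintegral_sq _ hf hfc := (complexVariance_linearStatistic hΓ hW hWb hf hfc).symm

end Diffraction

/-! ### Points of an arithmetic lattice in boxes -/

/-- The product is the absolute value of the norm of `a`, a nonzero integer. By the cardinality
hypothesis, the injective family `σ` exhausts the embeddings of `K` into `ℂ`. -/
theorem one_le_prod_abs_of_ne_zero {K : Type*} [Field K] [NumberField K] {ι : Type*} [Fintype ι]
    (hcard : Fintype.card ι = Module.finrank ℚ K) {σ : ι → (K →+* ℝ)}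
    (hσ : Function.Injective σ) {a : NumberField.RingOfIntegers K} (ha : a ≠ 0) :
    1 ≤ ∏ i, |σ i (a : K)| := by
  let τ : ι → (K →ₐ[ℚ] ℂ) := fun i => RingHom.equivRatAlgHom K ℂ (Complex.ofRealHom.comp (σ i))
  have hτ : Function.Bijective τ := by
    rw [Fintype.bijective_iff_injective_and_card, AlgHom.card]
    refine ⟨fun i j h => hσ ?_, hcard⟩
    have h' := (RingHom.equivRatAlgHom K ℂ).injective h
    ext x
    exact Complex.ofReal_injective (RingHom.congr_fun h' x)
  have hnorm : ((Algebra.norm ℤ a : ℤ) : ℂ) = ((∏ i, σ i (a : K) : ℝ) : ℂ) := by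
    have h := Algebra.norm_eq_prod_embeddings ℚ ℂ (a : K)
    rw [← Algebra.coe_norm_int, ← (Equiv.ofBijective τ hτ).prod_comp] at h
    have h2 : ∀ i, (Equiv.ofBijective τ hτ i) (a : K) = ((σ i (a : K) : ℝ) : ℂ) := fun i => rfl
    simp only [h2] at h
    rw [Complex.ofReal_prod, ← h]
    simp
  have hnorm' : ((Algebra.norm ℤ a : ℤ) : ℝ) = ∏ i, σ i (a : K) := by exact_mod_cast hnorm
  rw [← Finset.abs_prod, ← hnorm']
  have : Algebra.norm ℤ a ≠ 0 := Algebra.norm_ne_zero_iff.2 ha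
  exact_mod_cast Int.one_le_abs this

section Counting

variable {d₁ d₂ : ℕ}

theorem one_le_prod_abs_of_mem_arithmeticLattice {K : Type*} [Field K] [NumberField K]
    (hdeg : Module.finrank ℚ K = d₁ + d₂) {σ : Fin d₁ ⊕ Fin d₂ → (K →+* ℝ)}
    (hσ : Function.Injective σ) {ξ : Euc d₁ × Euc d₂} (hξ : ξ ∈ arithmeticLattice σ)
    (h0 : ξ ≠ 0) : 1 ≤ (∏ i, |ξ.1 i|) * ∏ j, |ξ.2 j| := by
  obtain ⟨a, rfl⟩ := hξ
  have ha : a ≠ 0 := by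
    rintro rfl
    refine h0 (Prod.ext ?_ ?_) <;> ext <;> simp
  have := one_le_prod_abs_of_ne_zero (ι := Fin d₁ ⊕ Fin d₂) (by simp [hdeg]) hσ ha
  rwa [Fintype.prod_sum_type] at this

theorem prod_abs_le_pow {d : ℕ} {x : Euc d} {M : ℝ} (h : ∀ i, |x i| ≤ M) :
    ∏ i, |x i| ≤ M ^ d :=
  (Finset.prod_le_prod (fun i _ => abs_nonneg (x i)) fun i _ => h i).trans (by simp)

theorem prod_abs_le_norm_pow {d : ℕ} (x : Euc d) : ∏ i, |x i| ≤ ‖x‖ ^ d :=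
  prod_abs_le_pow fun i => PiLp.norm_apply_le x i

theorem exists_nat_pow_bounds {X : ℝ} (hX : 1 ≤ X) {d : ℕ} (hd : d ≠ 0) :
    ∃ N : ℕ, X < (N : ℝ) ^ d ∧ (N : ℝ) ^ d ≤ 2 ^ d * X := by
  set Y := X ^ (1 / (d : ℝ)) with hY
  have hYd : Y ^ d = X := by
    rw [hY, one_div, Real.rpow_inv_natCast_pow (by linarith) hd]
  have hY1 : 1 ≤ Y := Real.one_le_rpow hX (by positivity)
  -- The upper bound is `⌊Y⌋ + 1 ≤ 2 Y`, valid because `Y ≥ 1`.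
  refine ⟨⌊Y⌋₊ + 1, ?_, ?_⟩
  · rw [← hYd]
    push_cast
    exact pow_lt_pow_left₀ (Nat.lt_floor_add_one Y) (by linarith) hd
  · have : ((⌊Y⌋₊ + 1 : ℕ) : ℝ) ≤ 2 * Y := by
      push_cast
      linarith [Nat.floor_le (by linarith : 0 ≤ Y)]
    refine (pow_le_pow_left₀ (by positivity) this d).trans ?_
    rw [mul_pow, hYd]

theorem floor_mem_Ico_of_norm_lt {d : ℕ} {x : Euc d} {R : ℝ} (hR : 0 < R) (hx : ‖x‖ < R)
    (N : ℕ) (hN : 0 < N) (i : Fin d) : ⌊x i * N / R⌋ ∈ Finset.Ico (-(N : ℤ)) N := by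
  have h := abs_lt.1 ((PiLp.norm_apply_le x i).trans_lt hx)
  have hN' : (0 : ℝ) < N := by exact_mod_cast hN
  rw [Finset.mem_Ico, Int.le_floor, Int.floor_lt]
  push_cast
  rw [le_div_iff₀ hR, div_lt_iff₀ hR]
  constructor <;> nlinarith

theorem abs_sub_le_of_floor_eq {d : ℕ} {x y : Euc d} {R : ℝ} (hR : 0 < R) {N : ℕ} (hN : 0 < N)
    {i : Fin d} (h : ⌊x i * N / R⌋ = ⌊y i * N / R⌋) : |(x - y) i| ≤ R / N := by
  have hN' : (0 : ℝ) < N := by exact_mod_cast hN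
  have h1 := Int.abs_sub_lt_one_of_floor_eq_floor h
  have h2 : x i * N / R - y i * N / R = (x - y) i * (N / R) := by
    simp only [PiLp.sub_apply]
    ring
  rw [h2, abs_mul, abs_of_pos (by positivity : 0 < (N : ℝ) / R)] at h1
  rw [le_div_iff₀ hN']
  rw [mul_div_assoc', div_lt_one hR] at h1
  exact h1.le

/-- Pigeonhole: divide the box into cells so small that the coordinates of a difference of two
points in one cell have product below `1`. By `hS` each cell then holds at most one point of `A`,
and the number of cells bounds the cardinality. -/
theorem card_le_of_norm_lt (hd : d₁ + d₂ ≠ 0) {S : Set (Euc d₁ × Euc d₂)}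
    (hsub : ∀ ξ ∈ S, ∀ ζ ∈ S, ξ - ζ ∈ S)
    (hS : ∀ ξ ∈ S, ξ ≠ 0 → 1 ≤ (∏ i, |ξ.1 i|) * ∏ j, |ξ.2 j|) {R T : ℝ} (hR : 0 < R) (hT : 0 < T)
    (A : Finset (Euc d₁ × Euc d₂)) (hA : ∀ ξ ∈ A, ξ ∈ S ∧ ξ ≠ 0 ∧ ‖ξ.1‖ < R ∧ ‖ξ.2‖ < T) :
    (A.card : ℝ) ≤ 4 ^ (d₁ + d₂) * (R ^ d₁ * T ^ d₂) := by
  classical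
  rcases A.eq_empty_or_nonempty with rfl | ⟨ξ₀, hξ₀⟩
  · simp only [Finset.card_empty, Nat.cast_zero]
    positivity
  -- A single point of `A` already forces this, and it permits `N ^ (d₁ + d₂)` to be comparable to
  -- `R ^ d₁ * T ^ d₂`.
  have hX : 1 ≤ R ^ d₁ * T ^ d₂ := by
    obtain ⟨h1, h2, h3, h4⟩ := hA _ hξ₀
    refine (hS _ h1 h2).trans ?_
    refine mul_le_mul ((prod_abs_le_norm_pow _).trans (pow_le_pow_left₀ (norm_nonneg _) h3.le _))
      ((prod_abs_le_norm_pow _).trans (pow_le_pow_left₀ (norm_nonneg _) h4.le _))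
      (Finset.prod_nonneg fun _ _ => abs_nonneg _) (by positivity)
  obtain ⟨N, hN1, hN2⟩ := exists_nat_pow_bounds hX hd
  have hN : 0 < N := by
    rcases Nat.eq_zero_or_pos N with rfl | h
    · rw [Nat.cast_zero, zero_pow hd] at hN1
      linarith
    · exact h
  have hN' : (0 : ℝ) < N := by exact_mod_cast hN
  let c : Euc d₁ × Euc d₂ → (Fin d₁ → ℤ) × (Fin d₂ → ℤ) := fun ξ =>
    (fun i => ⌊ξ.1 i * N / R⌋, fun j => ⌊ξ.2 j * N / T⌋)
  let B : Finset ((Fin d₁ → ℤ) × (Fin d₂ → ℤ)) :=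
    (Fintype.piFinset fun _ => Finset.Ico (-(N : ℤ)) N) ×ˢ
      (Fintype.piFinset fun _ => Finset.Ico (-(N : ℤ)) N)
  have hmaps : ∀ ξ ∈ A, c ξ ∈ B := by
    intro ξ hξ
    obtain ⟨-, -, h3, h4⟩ := hA _ hξ
    simp only [c, B, Finset.mem_product, Fintype.mem_piFinset]
    exact ⟨floor_mem_Ico_of_norm_lt hR h3 N hN, floor_mem_Ico_of_norm_lt hT h4 N hN⟩
  have hinj : Set.InjOn c A := by
    intro ξ hξ ζ hζ h
    by_contra hne
    have h1 := hS _ (hsub _ (hA _ hξ).1 _ (hA _ hζ).1) (sub_ne_zero.2 hne)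
    have h2 : ∏ i, |(ξ - ζ).1 i| ≤ (R / N) ^ d₁ := by
      refine prod_abs_le_pow fun i => ?_
      exact abs_sub_le_of_floor_eq hR hN (congrFun (congrArg Prod.fst h) i)
    have h3 : ∏ i, |(ξ - ζ).2 i| ≤ (T / N) ^ d₂ := by
      refine prod_abs_le_pow fun i => ?_
      exact abs_sub_le_of_floor_eq hT hN (congrFun (congrArg Prod.snd h) i)
    have h4 := h1.trans (mul_le_mul h2 h3 (Finset.prod_nonneg fun _ _ => abs_nonneg _)
      (by positivity))
    rw [div_pow, div_pow, div_mul_div_comm, ← pow_add, one_le_div (by positivity)] at h4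
    linarith
  have hcard := Finset.card_le_card_of_injOn c hmaps hinj
  have hB : (B.card : ℝ) = 2 ^ (d₁ + d₂) * (N : ℝ) ^ (d₁ + d₂) := by
    have : (Finset.Ico (-(N : ℤ)) N).card = 2 * N := by
      rw [Int.card_Ico]
      omega
    simp only [B, Finset.card_product, Fintype.card_piFinset, this, Finset.prod_const,
      Finset.card_univ, Fintype.card_fin]
    push_cast
    ring
  -- One factor `2 ^ (d₁ + d₂)` counts `2 N` intervals per coordinate, the other is the loss in
  -- rounding `N` up.
  calc (A.card : ℝ) ≤ B.card := by exact_mod_cast hcard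
    _ = 2 ^ (d₁ + d₂) * (N : ℝ) ^ (d₁ + d₂) := hB
    _ ≤ 2 ^ (d₁ + d₂) * (2 ^ (d₁ + d₂) * (R ^ d₁ * T ^ d₂)) := by gcongr
    _ = 4 ^ (d₁ + d₂) * (R ^ d₁ * T ^ d₂) := by
      rw [← mul_assoc, ← mul_pow]
      norm_num

open scoped Classical in
theorem tsum_ite_le_of_norm_lt (hd : d₁ + d₂ ≠ 0) {S : Set (Euc d₁ × Euc d₂)}
    (hsub : ∀ ξ ∈ S, ∀ ζ ∈ S, ξ - ζ ∈ S)
    (hS : ∀ ξ ∈ S, ξ ≠ 0 → 1 ≤ (∏ i, |ξ.1 i|) * ∏ j, |ξ.2 j|) {R T : ℝ} (hR : 0 < R)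
    (hT : 0 < T) :
    ∑' ξ : S, (if (ξ : Euc d₁ × Euc d₂) ≠ 0 ∧ ‖(ξ : Euc d₁ × Euc d₂).1‖ < R ∧
      ‖(ξ : Euc d₁ × Euc d₂).2‖ < T then (1 : ℝ≥0∞) else 0) ≤
      ENNReal.ofReal (4 ^ (d₁ + d₂) * (R ^ d₁ * T ^ d₂)) := by
  rw [ENNReal.tsum_eq_iSup_sum]
  refine iSup_le fun s => ?_
  rw [← Finset.sum_filter, Finset.sum_const, nsmul_one]
  set A := (s.filter fun ξ : S => (ξ : Euc d₁ × Euc d₂) ≠ 0 ∧ ‖(ξ : Euc d₁ × Euc d₂).1‖ < R ∧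
    ‖(ξ : Euc d₁ × Euc d₂).2‖ < T)
  have := card_le_of_norm_lt hd hsub hS hR hT (A.map (Function.Embedding.subtype _)) (by
    intro ξ hξ
    obtain ⟨ζ, hζ, rfl⟩ := Finset.mem_map.1 hξ
    exact ⟨ζ.2, (Finset.mem_filter.1 hζ).2⟩)
  rw [Finset.card_map] at this
  rw [← ENNReal.ofReal_natCast]
  exact ENNReal.ofReal_le_ofReal this

theorem sub_mem_dualLattice {Γ : Submodule ℤ (Euc d₁ × Euc d₂)} {ξ ζ : Euc d₁ × Euc d₂}
    (hξ : ξ ∈ dualLattice Γ) (hζ : ζ ∈ dualLattice Γ) : ξ - ζ ∈ dualLattice Γ := by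
  intro γ hγ
  obtain ⟨n, hn⟩ := hξ γ hγ
  obtain ⟨m, hm⟩ := hζ γ hγ
  refine ⟨n - m, ?_⟩
  simp only [Prod.fst_sub, Prod.snd_sub, inner_sub_left]
  push_cast
  linarith

end Counting

/-! ### Decay of the diffraction measure at the origin -/

section Dyadic

theorem exists_dyadic_shell {a x : ℝ} (ha : 0 < a) (hx : a ≤ x) :
    ∃ k : ℕ, a * 2 ^ k ≤ x ∧ x < a * 2 ^ (k + 1) := by
  obtain ⟨k, h1, h2⟩ := exists_nat_pow_near ((one_le_div ha).2 hx) (one_lt_two (α := ℝ))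
  exact ⟨k, by rwa [le_div_iff₀' ha] at h1, by rwa [div_lt_iff₀' ha] at h2⟩

theorem tsum_ofReal_mul_geometric {c q : ℝ} (hc : 0 ≤ c) (hq0 : 0 ≤ q) (hq1 : q < 1) :
    ∑' k : ℕ, ENNReal.ofReal (c * q ^ k) = ENNReal.ofReal (c * (1 - q)⁻¹) := by
  rw [← ENNReal.ofReal_tsum_of_nonneg (fun k => by positivity)
    ((summable_geometric_of_lt_one hq0 hq1).mul_left c), tsum_mul_left,
    tsum_geometric_of_lt_one hq0 hq1]

theorem mul_two_pow_rpow {a : ℝ} (ha : 0 < a) (k : ℕ) (s : ℝ) :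
    (a * 2 ^ k) ^ s = a ^ s * ((2 : ℝ) ^ s) ^ k := by
  rw [Real.mul_rpow ha.le (by positivity), ← Real.rpow_natCast, ← Real.rpow_mul zero_le_two,
    ← Real.rpow_mul_natCast zero_le_two, mul_comm (k : ℝ)]

/-- A function with decay of order `p` integrates, after scaling by `ε`, to `O(ε^s)` against a
measure with `η(B_R) = O(R^s)`, where `s < p`. -/
theorem exists_lintegral_comp_smul_le {d : ℕ} {η : Measure (Euc d)} {C s : ℝ} (hC : 0 < C)
    (hη : ∀ R : ℝ, 0 < R → η (ball 0 R) ≤ ENNReal.ofReal (C * R ^ s)) {g : Euc d → ℝ} {D : ℝ}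
    (hD : 0 < D) {p : ℕ} (hp : s < p) (hg1 : ∀ u, g u ≤ D) (hg2 : ∀ u, ‖u‖ ^ p * g u ≤ D) :
    ∃ C' : ℝ, 0 < C' ∧ ∀ ε : ℝ, 0 < ε →
      ∫⁻ ξ, ENNReal.ofReal (g (ε⁻¹ • ξ)) ∂η ≤ ENNReal.ofReal (C' * ε ^ s) := by
  -- From one dyadic shell to the next the mass bound grows by `2 ^ s` and the bound on `g` shrinks
  -- by `2 ^ p`.
  set q : ℝ := 2 ^ (s - p) with hq
  have hq0 : 0 < q := by positivity
  have hq1 : q < 1 := Real.rpow_lt_one_of_one_lt_of_neg one_lt_two (by linarith)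
  refine ⟨D * C * 2 ^ s * (1 - q)⁻¹, by
    have : 0 < 1 - q := by linarith
    positivity, fun ε hε => ?_⟩
  have hpt : ∀ ξ : Euc d, ENNReal.ofReal (g (ε⁻¹ • ξ)) ≤
      ∑' k : ℕ, (ball (0 : Euc d) (ε * 2 ^ (k + 1))).indicator
        (fun _ => ENNReal.ofReal (D * ((2 : ℝ) ^ p)⁻¹ ^ k)) ξ := by
    intro ξ
    have hn : ‖ε⁻¹ • ξ‖ = ε⁻¹ * ‖ξ‖ := by
      rw [norm_smul, Real.norm_eq_abs, abs_of_pos (by positivity)]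
    obtain ⟨k, hk1, hk2⟩ : ∃ k : ℕ, g (ε⁻¹ • ξ) ≤ D * ((2 : ℝ) ^ p)⁻¹ ^ k ∧
        ‖ξ‖ < ε * 2 ^ (k + 1) := by
      rcases lt_or_ge ‖ξ‖ ε with h | h
      · refine ⟨0, by simpa using hg1 _, ?_⟩
        simp only [zero_add, pow_one]
        linarith
      · obtain ⟨k, hk1, hk2⟩ := exists_dyadic_shell hε h
        refine ⟨k, ?_, hk2⟩
        -- No sign is assumed for `g`, and the lower bound on the norm can be multiplied through
        -- only when `g` is positive.
        by_cases hg0 : g (ε⁻¹ • ξ) ≤ 0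
        · exact hg0.trans (by positivity)
        have h1 : (2 : ℝ) ^ k ≤ ‖ε⁻¹ • ξ‖ := by
          rw [hn, le_inv_mul_iff₀ hε]
          exact hk1
        have h2 := hg2 (ε⁻¹ • ξ)
        have h3 : ((2 : ℝ) ^ k) ^ p * g (ε⁻¹ • ξ) ≤ D :=
          (mul_le_mul_of_nonneg_right (pow_le_pow_left₀ (by positivity) h1 p)
            (not_le.1 hg0).le).trans h2
        rw [inv_pow, ← pow_mul, mul_comm p k, pow_mul, ← div_eq_mul_inv,
          le_div_iff₀' (by positivity)]
        exact h3
    refine le_trans ?_ (ENNReal.le_tsum k)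
    rw [Set.indicator_of_mem (mem_ball_zero_iff.2 hk2)]
    exact ENNReal.ofReal_le_ofReal hk1
  calc ∫⁻ ξ, ENNReal.ofReal (g (ε⁻¹ • ξ)) ∂η
      ≤ ∫⁻ ξ, ∑' k : ℕ, (ball (0 : Euc d) (ε * 2 ^ (k + 1))).indicator
        (fun _ => ENNReal.ofReal (D * ((2 : ℝ) ^ p)⁻¹ ^ k)) ξ ∂η := lintegral_mono hpt
    _ = ∑' k : ℕ, ENNReal.ofReal (D * ((2 : ℝ) ^ p)⁻¹ ^ k) *
        η (ball (0 : Euc d) (ε * 2 ^ (k + 1))) := by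
      rw [lintegral_tsum fun k => (measurable_const.indicator measurableSet_ball).aemeasurable]
      exact tsum_congr fun k => lintegral_indicator_const measurableSet_ball _
    _ ≤ ∑' k : ℕ, ENNReal.ofReal (D * C * 2 ^ s * ε ^ s * q ^ k) := by
      refine ENNReal.tsum_le_tsum fun k => ?_
      refine (mul_le_mul_right (hη _ (by positivity)) _).trans ?_
      rw [← ENNReal.ofReal_mul (by positivity)]
      refine ENNReal.ofReal_le_ofReal (le_of_eq ?_)
      have hqk : q ^ k = ((2 : ℝ) ^ s) ^ k * ((2 : ℝ) ^ p)⁻¹ ^ k := by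
        rw [hq, Real.rpow_sub two_pos, Real.rpow_natCast, div_eq_mul_inv, mul_pow]
      rw [mul_two_pow_rpow hε, hqk, pow_succ]
      ring
    _ = _ := by
      rw [tsum_ofReal_mul_geometric (by positivity) hq0.le hq1]
      congr 1
      ring

end Dyadic

/-- A compactly supported test function whose Fourier transform is at least `1` in absolute value
on the unit ball, and rapidly decaying. -/
theorem exists_testFunction (d : ℕ) : ∃ φ : Euc d → ℂ, Continuous φ ∧ HasCompactSupport φ ∧
    (∀ u ∈ ball (0 : Euc d) 1, 1 ≤ ‖𝓕 φ u‖) ∧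
    ∀ p : ℕ, ∃ D : ℝ, 0 < D ∧ ∀ u, ‖𝓕 φ u‖ ^ 2 ≤ D ∧ ‖u‖ ^ p * ‖𝓕 φ u‖ ^ 2 ≤ D := by
  -- On the support `‖x‖ ≤ 1/16`, so for `‖u‖ < 1` the phase is at most `2π/16 ≤ 1/2` and `‖exp(…) -
  -- 1‖ ≤ 1/2`. With total mass `2` this gives `‖𝓕 φ u - 2‖ ≤ 1`, hence `‖𝓕 φ u‖ ≥ 1`.
  let β : ContDiffBump (0 : Euc d) := ⟨1 / 32, 1 / 16, by norm_num, by norm_num⟩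
  set ψ : Euc d → ℝ := β.normed volume with hψ
  have hψc : Continuous ψ := β.continuous_normed
  have hψs : HasCompactSupport ψ := β.hasCompactSupport_normed
  have hψi : Integrable ψ := hψc.integrable_of_hasCompactSupport hψs
  set φ : Euc d → ℂ := fun x => ((2 * ψ x : ℝ) : ℂ) with hφ
  have hφs : HasCompactSupport φ := hψs.comp_left (g := fun y : ℝ => ((2 * y : ℝ) : ℂ)) (by simp)
  have hφd : ContDiff ℝ (⊤ : ℕ∞) φ :=
    Complex.ofRealCLM.contDiff.comp (contDiff_const.mul β.contDiff_normed)
  have hφi : Integrable φ := (hψi.const_mul 2).ofReal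
  have hint : ∫ x, φ x = 2 := by
    rw [integral_complex_ofReal, integral_const_mul, β.integral_normed]
    simp
  refine ⟨φ, hφd.continuous, hφs, fun u hu => ?_, fun p => ?_⟩
  · have hu' : ‖u‖ < 1 := by simpa using hu
    have h1 : ‖𝓕 φ u - 2‖ ≤ 1 := by
      rw [← hint, Real.fourier_eq', ← integral_sub]
      · have hle : ∀ x, ‖Complex.exp (((-2 * Real.pi * inner ℝ x u : ℝ) : ℂ) * Complex.I) • φ x -
            φ x‖ ≤ ψ x := by
          intro x
          have h2 : Complex.exp (((-2 * Real.pi * inner ℝ x u : ℝ) : ℂ) * Complex.I) • φ x - φ x =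
              (Complex.exp (Complex.I * ((-2 * Real.pi * inner ℝ x u : ℝ) : ℂ)) - 1) * φ x := by
            rw [smul_eq_mul, mul_comm Complex.I]
            ring
          have hψ0 : 0 ≤ ψ x := β.nonneg_normed x
          have h3 : ‖φ x‖ = 2 * ψ x := by
            rw [hφ, Complex.norm_real, Real.norm_eq_abs, abs_of_nonneg (by positivity)]
          rw [h2, norm_mul, h3]
          by_cases hx : ψ x = 0
          · simp [hx]
          have hx' : ‖x‖ ≤ 1 / 16 := by
            have : x ∈ tsupport ψ := subset_tsupport ψ hx
            rw [hψ, β.tsupport_normed_eq] at this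
            simpa [β] using this
          have h4 : ‖Complex.exp (Complex.I * ((-2 * Real.pi * inner ℝ x u : ℝ) : ℂ)) - 1‖ ≤
              1 / 2 := by
            refine Real.norm_exp_I_mul_ofReal_sub_one_le.trans ?_
            have h5 : |inner ℝ x u| ≤ 1 / 16 * 1 :=
              (abs_real_inner_le_norm x u).trans
                (mul_le_mul hx' hu'.le (norm_nonneg _) (by norm_num))
            rw [Real.norm_eq_abs, abs_mul, abs_mul, abs_of_pos Real.pi_pos]
            norm_num at h5 ⊢
            nlinarith [Real.pi_lt_four, Real.pi_pos, abs_nonneg (inner ℝ x u)]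
          nlinarith
        refine (norm_integral_le_of_norm_le hψi (Eventually.of_forall hle)).trans ?_
        rw [β.integral_normed]
      · refine hφi.bdd_mul (c := 1) ?_ (Eventually.of_forall fun x => ?_)
        · exact Continuous.aestronglyMeasurable (by fun_prop)
        · rw [Complex.norm_exp_ofReal_mul_I]
      · exact hφi
    have h2 : ‖(2 : ℂ)‖ ≤ ‖𝓕 φ u‖ + ‖𝓕 φ u - 2‖ := norm_le_norm_add_norm_sub _ _
    have h3 : ‖(2 : ℂ)‖ = 2 := by simp
    linarith
  -- Rapid decay holds because `φ` is smooth with compact support, so its transform is a Schwartz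
  -- function.
  · set Ψ := 𝓕 (hφs.toSchwartzMap hφd) with hΨ
    have hΨe : ∀ u, Ψ u = 𝓕 φ u := fun u => by
      rw [hΨ, SchwartzMap.fourier_coe]
      rfl
    obtain ⟨C₀, hC₀, h0⟩ := Ψ.decay 0 0
    obtain ⟨C₁, hC₁, h1⟩ := Ψ.decay p 0
    simp only [pow_zero, one_mul, norm_iteratedFDeriv_zero, hΨe] at h0 h1
    refine ⟨C₀ * C₀ + C₁ * C₀, by positivity, fun u => ⟨?_, ?_⟩⟩
    · rw [sq]
      have := mul_le_mul (h0 u) (h0 u) (norm_nonneg _) hC₀.le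
      nlinarith [mul_pos hC₁ hC₀]
    · rw [sq, ← mul_assoc]
      have := mul_le_mul (h1 u) (h0 u) (norm_nonneg _) hC₁.le
      nlinarith [mul_pos hC₀ hC₀]

theorem fourier_comp_smul {d : ℕ} (φ : Euc d → ℂ) {ε : ℝ} (hε : 0 < ε) (ξ : Euc d) :
    𝓕 (fun x => (ε : ℂ) ^ d * φ (ε • x)) ξ = 𝓕 φ (ε⁻¹ • ξ) := by
  rw [Real.fourier_eq', Real.fourier_eq']
  have h := Measure.integral_comp_smul (volume : Measure (Euc d)) (fun x =>
    Complex.exp (((-2 * Real.pi * inner ℝ x (ε⁻¹ • ξ) : ℝ) : ℂ) * Complex.I) • φ x) ε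
  have hi : ∀ x : Euc d, (inner ℝ (ε • x) (ε⁻¹ • ξ) : ℝ) = inner ℝ x ξ := fun x => by
    rw [real_inner_smul_left, real_inner_smul_right, ← mul_assoc, mul_inv_cancel₀ hε.ne', one_mul]
  simp only [hi, finrank_euclideanSpace_fin] at h
  rw [abs_of_pos (by positivity)] at h
  have h2 : ∀ x : Euc d, Complex.exp (((-2 * Real.pi * inner ℝ x ξ : ℝ) : ℂ) * Complex.I) •
      ((ε : ℂ) ^ d * φ (ε • x)) = (ε : ℂ) ^ d *
      (Complex.exp (((-2 * Real.pi * inner ℝ x ξ : ℝ) : ℂ) * Complex.I) • φ (ε • x)) := fun x => by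
    simp only [smul_eq_mul]
    ring
  simp only [h2]
  rw [integral_const_mul, h, Complex.real_smul, ← mul_assoc]
  push_cast
  rw [mul_inv_cancel₀ (pow_ne_zero _ (by exact_mod_cast hε.ne')), one_mul]

section Decay

variable {d₁ d₂ : ℕ} {Γ : Submodule ℤ (Euc d₁ × Euc d₂)} [DiscreteTopology Γ] [IsZLattice ℝ Γ]

theorem exists_diffractionWeight_le {W : Set (Euc d₂)} {ϑ : ℝ} (hϑ : IsFourierSmooth W ϑ) :
    ∃ C : ℝ, 0 < C ∧ ∀ ξ : Euc d₁ × Euc d₂, ∀ T : ℝ, 0 < T → T ≤ ‖ξ.2‖ →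
      diffractionWeight Γ W ξ ≤ C * T ^ (-((d₂ : ℝ) + ϑ)) := by
  obtain ⟨hϑ0, C, hC⟩ := hϑ
  set κ := (volume (fundDomain Γ)).toReal⁻¹ with hκ
  -- The summand `1` only secures strict positivity.
  refine ⟨(κ * C) ^ 2 + 1, by positivity, fun ξ T hT hTξ => ?_⟩
  have hT' : 0 ≤ T ^ (-((d₂ : ℝ) + ϑ)) := by positivity
  unfold diffractionWeight
  split_ifs with h
  · positivity
  have hκ0 : 0 ≤ κ := by positivity
  have h1 : (1 + ‖ξ.2‖) ^ (-((d₂ : ℝ) + ϑ)) ≤ T ^ (-((d₂ : ℝ) + ϑ)) :=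
    Real.rpow_le_rpow_of_nonpos hT (by linarith)
      (by have : (0 : ℝ) ≤ d₂ := by positivity
          linarith)
  have h2 : ((1 + ‖ξ.2‖) ^ (-((d₂ : ℝ) + ϑ) / 2)) ^ 2 = (1 + ‖ξ.2‖) ^ (-((d₂ : ℝ) + ϑ)) := by
    rw [← Real.rpow_mul_natCast (by positivity)]
    congr 1
    push_cast
    ring
  calc (κ * ‖𝓕 (W.indicator (fun _ => (1 : ℂ))) ξ.2‖) ^ 2
      ≤ (κ * (C * (1 + ‖ξ.2‖) ^ (-((d₂ : ℝ) + ϑ) / 2))) ^ 2 := by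
        gcongr
        exact hC _
    _ = (κ * C) ^ 2 * (1 + ‖ξ.2‖) ^ (-((d₂ : ℝ) + ϑ)) := by
        rw [← h2]
        ring
    _ ≤ (κ * C) ^ 2 * T ^ (-((d₂ : ℝ) + ϑ)) := by gcongr
    _ ≤ ((κ * C) ^ 2 + 1) * T ^ (-((d₂ : ℝ) + ϑ)) := by nlinarith

/-- The product bound leaves no frequency with `‖ξ₁‖ < R` and `‖ξ₂‖ < T₀`. Beyond `T₀`, the point
count in each dyadic shell is played against the Fourier decay of the window; the powers of `2 ^ (k
* d₂)` cancel and `2 ^ (-k * ϑ)` remains. -/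
theorem exists_diffractionMeasure_ball_le (hd₂ : 1 ≤ d₂)
    (hS : ∀ ξ ∈ dualLattice Γ, ξ ≠ 0 → 1 ≤ (∏ i, |ξ.1 i|) * ∏ j, |ξ.2 j|) {W : Set (Euc d₂)}
    {ϑ : ℝ} (hϑ : IsFourierSmooth W ϑ) :
    ∃ C : ℝ, 0 < C ∧ ∀ R : ℝ, 0 < R →
      diffractionMeasure Γ W (ball 0 R) ≤ ENNReal.ofReal (C * R ^ (d₁ + d₁ * ϑ / d₂)) := by
  classical
  obtain ⟨C, hC, hw⟩ := exists_diffractionWeight_le (Γ := Γ) hϑ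
  have hϑ0 := hϑ.1
  have hd₂' : (0 : ℝ) < d₂ := by exact_mod_cast hd₂
  set q : ℝ := 2 ^ (-ϑ) with hq
  have hq0 : 0 < q := by positivity
  have hq1 : q < 1 := Real.rpow_lt_one_of_one_lt_of_neg one_lt_two (by linarith)
  refine ⟨C * 4 ^ (d₁ + d₂) * 2 ^ d₂ * (1 - q)⁻¹, by
    have : 0 < 1 - q := by linarith
    positivity, fun R hR => ?_⟩
  -- This is the threshold at which `R ^ d₁ * T₀ ^ d₂ = 1`.
  set T₀ : ℝ := R ^ (-((d₁ : ℝ) / d₂)) with hT₀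
  have hT₀0 : 0 < T₀ := by positivity
  have hT₀d : R ^ d₁ * T₀ ^ d₂ = 1 := by
    rw [hT₀, ← Real.rpow_mul_natCast hR.le, ← Real.rpow_natCast, ← Real.rpow_add hR]
    rw [neg_mul, div_mul_cancel₀ _ hd₂'.ne', add_neg_cancel, Real.rpow_zero]
  let I : ℕ → dualLattice Γ → ℝ≥0∞ := fun k ξ =>
    if (ξ : Euc d₁ × Euc d₂) ≠ 0 ∧ ‖(ξ : Euc d₁ × Euc d₂).1‖ < R ∧
      ‖(ξ : Euc d₁ × Euc d₂).2‖ < T₀ * 2 ^ (k + 1) then 1 else 0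
  have hpt : ∀ ξ : dualLattice Γ,
      ENNReal.ofReal (diffractionWeight Γ W ξ) *
        (ball (0 : Euc d₁) R).indicator 1 (ξ : Euc d₁ × Euc d₂).1 ≤
      ∑' k : ℕ, ENNReal.ofReal (C * (T₀ * 2 ^ k) ^ (-((d₂ : ℝ) + ϑ))) * I k ξ := by
    intro ξ
    by_cases hξ : (ξ : Euc d₁ × Euc d₂) = 0
    · simp [diffractionWeight, hξ]
    by_cases hξR : ‖(ξ : Euc d₁ × Euc d₂).1‖ < R
    · have h1 := hS _ ξ.2 hξ
      have h2 : 1 ≤ R ^ d₁ * ‖(ξ : Euc d₁ × Euc d₂).2‖ ^ d₂ :=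
        h1.trans (mul_le_mul ((prod_abs_le_norm_pow _).trans
          (pow_le_pow_left₀ (norm_nonneg _) hξR.le _)) (prod_abs_le_norm_pow _)
          (Finset.prod_nonneg fun _ _ => abs_nonneg _) (by positivity))
      have h3 : T₀ ≤ ‖(ξ : Euc d₁ × Euc d₂).2‖ := by
        rw [← hT₀d] at h2
        have := le_of_mul_le_mul_left h2 (by positivity)
        exact le_of_pow_le_pow_left₀ (by omega) (norm_nonneg _) this
      obtain ⟨k, hk1, hk2⟩ := exists_dyadic_shell hT₀0 h3
      refine le_trans ?_ (ENNReal.le_tsum k)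
      simp only [I]
      rw [if_pos ⟨hξ, hξR, hk2⟩, Set.indicator_of_mem (mem_ball_zero_iff.2 hξR)]
      simp only [Pi.one_apply, mul_one]
      exact ENNReal.ofReal_le_ofReal (hw _ _ (by positivity) hk1)
    · rw [Set.indicator_of_notMem (by simpa using hξR), mul_zero]
      exact zero_le
  calc diffractionMeasure Γ W (ball 0 R)
      = ∑' ξ : dualLattice Γ, ENNReal.ofReal (diffractionWeight Γ W ξ) *
        (ball (0 : Euc d₁) R).indicator 1 (ξ : Euc d₁ × Euc d₂).1 := by
        rw [diffractionMeasure, Measure.sum_apply _ measurableSet_ball]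
        refine tsum_congr fun ξ => ?_
        rw [Measure.smul_apply, Measure.dirac_apply' _ measurableSet_ball, smul_eq_mul]
    _ ≤ ∑' (ξ : dualLattice Γ) (k : ℕ),
        ENNReal.ofReal (C * (T₀ * 2 ^ k) ^ (-((d₂ : ℝ) + ϑ))) * I k ξ :=
        ENNReal.tsum_le_tsum hpt
    _ = ∑' k : ℕ, ENNReal.ofReal (C * (T₀ * 2 ^ k) ^ (-((d₂ : ℝ) + ϑ))) *
        ∑' ξ : dualLattice Γ, I k ξ := by
        rw [ENNReal.tsum_comm]
        exact tsum_congr fun k => ENNReal.tsum_mul_left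
    _ ≤ ∑' k : ℕ, ENNReal.ofReal
        (C * 4 ^ (d₁ + d₂) * 2 ^ d₂ * R ^ (d₁ + d₁ * ϑ / d₂) * q ^ k) := by
        refine ENNReal.tsum_le_tsum fun k => ?_
        refine (mul_le_mul_right (tsum_ite_le_of_norm_lt (by omega)
          (fun ξ hξ ζ hζ => sub_mem_dualLattice hξ hζ) hS hR
          (by positivity : 0 < T₀ * 2 ^ (k + 1))) _).trans ?_
        rw [← ENNReal.ofReal_mul (by positivity)]
        refine ENNReal.ofReal_le_ofReal (le_of_eq ?_)
        -- The gain over the volume exponent `d₁` arises here: count times weight is `R ^ d₁ * T₀ ^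
        -- (-ϑ) * q ^ k` up to constants.
        have e0 : T₀ ^ (-ϑ) = R ^ (d₁ * ϑ / d₂) := by
          rw [hT₀, ← Real.rpow_mul hR.le]
          congr 1
          ring
        have e1 : (T₀ * 2 ^ k) ^ (-((d₂ : ℝ) + ϑ)) =
            ((T₀ * 2 ^ k) ^ d₂)⁻¹ * ((R ^ (d₁ * ϑ / d₂)) * q ^ k) := by
          rw [neg_add, Real.rpow_add (by positivity), Real.rpow_neg (by positivity),
            Real.rpow_natCast, mul_two_pow_rpow hT₀0 k (-ϑ), e0]
        have e2 : (T₀ * 2 ^ (k + 1)) ^ d₂ = (T₀ * 2 ^ k) ^ d₂ * 2 ^ d₂ := by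
          rw [← mul_pow]
          ring
        have e3 : ((T₀ * 2 ^ k) ^ d₂)⁻¹ * (T₀ * 2 ^ k) ^ d₂ = 1 :=
          inv_mul_cancel₀ (by positivity)
        rw [e1, e2, Real.rpow_add hR, Real.rpow_natCast]
        linear_combination (C * R ^ (d₁ * ϑ / d₂) * q ^ k * 4 ^ (d₁ + d₂) * R ^ d₁ * 2 ^ d₂) * e3
    _ = _ := by
        rw [tsum_ofReal_mul_geometric (by positivity) hq0.le hq1]
        congr 1
        ring

/-- An arbitrary centered diffraction is tied to the explicit measure through the variance of one
test function at scale `ε⁻¹`, so the two measures need not be identified. -/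
theorem diffractionDecay_cutProjectProcess (hd₁ : 1 ≤ d₁) (hd₂ : 1 ≤ d₂)
    (hΓ : IsCutProjectLattice Γ)
    (hS : ∀ ξ ∈ dualLattice Γ, ξ ≠ 0 → 1 ≤ (∏ i, |ξ.1 i|) * ∏ j, |ξ.2 j|) {W : Set (Euc d₂)}
    (hW : MeasurableSet W) (hWb : Bornology.IsBounded W) {ϑ : ℝ} (hϑ : IsFourierSmooth W ϑ) :
    DiffractionDecay (torusMeasure Γ) (cutProjectProcess Γ W) (d₁ * ϑ / d₂) := by
  intro η hη
  obtain ⟨C, hC, hball⟩ := exists_diffractionMeasure_ball_le hd₂ hS hϑ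
  obtain ⟨φ, hφc, hφs, hφ1, hφD⟩ := exists_testFunction d₁
  -- The decay of `𝓕 φ` must beat the growth exponent of the diffraction mass for the dyadic series
  -- to converge.
  obtain ⟨p, hp⟩ := exists_nat_gt ((d₁ : ℝ) + d₁ * ϑ / d₂)
  obtain ⟨D, hD, hφD⟩ := hφD p
  obtain ⟨C', hC', hint⟩ := exists_lintegral_comp_smul_le hC hball hD hp
    (g := fun u => ‖𝓕 φ u‖ ^ 2) (fun u => (hφD u).1) fun u => (hφD u).2
  have : Nonempty (Fin d₁) := ⟨⟨0, hd₁⟩⟩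
  set v := (volume (ball (0 : Euc d₁) 1)).toReal with hv
  have hv0 : 0 < v := ENNReal.toReal_pos (measure_ball_pos _ _ one_pos).ne' measure_ball_lt_top.ne
  refine ⟨C' / v, by positivity, fun ε hε => ?_⟩
  have hvol : volume (ball (0 : Euc d₁) ε) = ENNReal.ofReal (ε ^ d₁ * v) := by
    rw [Measure.addHaar_ball _ _ hε.le, finrank_euclideanSpace_fin,
      ENNReal.ofReal_mul (by positivity), hv, ENNReal.ofReal_toReal measure_ball_lt_top.ne]
  set f : Euc d₁ → ℂ := fun x => (ε : ℂ) ^ d₁ * φ (ε • x) with hf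
  have hfc : Continuous f := by fun_prop
  have hfs : HasCompactSupport f :=
    (hφs.comp_smul hε.ne').mul_left
  have hF : ∀ ξ, 𝓕 f ξ = 𝓕 φ (ε⁻¹ • ξ) := fourier_comp_smul φ hε
  have hηball : η (ball 0 ε) ≤ ENNReal.ofReal (C' * ε ^ ((d₁ : ℝ) + d₁ * ϑ / d₂)) := by
    calc η (ball 0 ε) = ∫⁻ ξ, (ball (0 : Euc d₁) ε).indicator 1 ξ ∂η :=
          (lintegral_indicator_one measurableSet_ball).symm
      _ ≤ ∫⁻ ξ, ‖𝓕 f ξ‖ₑ ^ 2 ∂η := by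
          refine lintegral_mono fun ξ => ?_
          by_cases hξ : ξ ∈ ball (0 : Euc d₁) ε
          swap
          · rw [Set.indicator_of_notMem hξ]
            exact zero_le
          rw [Set.indicator_of_mem hξ]
          have h1 : 1 ≤ ‖𝓕 f ξ‖ := by
            rw [hF]
            refine hφ1 _ (mem_ball_zero_iff.2 ?_)
            rw [norm_smul, Real.norm_eq_abs, abs_of_pos (by positivity), inv_mul_lt_iff₀ hε]
            simpa using hξ
          have h2 : 1 ≤ ‖𝓕 f ξ‖ₑ := by
            rw [← ofReal_norm, ENNReal.one_le_ofReal]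
            exact h1
          exact one_le_pow₀ h2
      _ = ∫⁻ ξ, ‖𝓕 f ξ‖ₑ ^ 2 ∂(diffractionMeasure Γ W) := by
          rw [hη.lintegral_sq f hfc hfs, complexVariance_linearStatistic hΓ hW hWb hfc hfs]
      _ = ∫⁻ ξ, ENNReal.ofReal (‖𝓕 φ (ε⁻¹ • ξ)‖ ^ 2) ∂(diffractionMeasure Γ W) := by
          refine lintegral_congr fun ξ => ?_
          rw [hF, ENNReal.ofReal_pow (norm_nonneg _), ofReal_norm]
      _ ≤ _ := hint ε hε
  rw [hvol]
  refine ENNReal.div_le_of_le_mul ?_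
  rw [← ENNReal.ofReal_mul (by positivity)]
  refine hηball.trans (ENNReal.ofReal_le_ofReal (le_of_eq ?_))
  rw [Real.rpow_add hε, Real.rpow_natCast]
  field_simp

/-- The explicit measure is the witness: its ball bound makes it locally finite, and the decay
exponent `d₁ * ϑ / d₂` is positive. -/
theorem isHyperuniform_cutProjectProcess (hd₁ : 1 ≤ d₁) (hd₂ : 1 ≤ d₂)
    (hΓ : IsCutProjectLattice Γ)
    (hS : ∀ ξ ∈ dualLattice Γ, ξ ≠ 0 → 1 ≤ (∏ i, |ξ.1 i|) * ∏ j, |ξ.2 j|) {W : Set (Euc d₂)}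
    (hW : MeasurableSet W) (hWb : Bornology.IsBounded W) {ϑ : ℝ} (hϑ : IsFourierSmooth W ϑ) :
    IsHyperuniform (torusMeasure Γ) (cutProjectProcess Γ W) := by
  obtain ⟨C, hC, hball⟩ := exists_diffractionMeasure_ball_le hd₂ hS hϑ
  have hη := isCenteredDiffraction_diffractionMeasure hΓ hW hWb
    fun R hR => (hball R hR).trans_lt ENNReal.ofReal_lt_top
  refine ⟨isLocallySquareIntegrable_cutProjectProcess hΓ hW hWb, _, hη, ?_⟩
  obtain ⟨C', -, hdec⟩ := diffractionDecay_cutProjectProcess hd₁ hd₂ hΓ hS hW hWb hϑ _ hη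
  set s := (d₁ : ℝ) * ϑ / d₂ with hs
  have hs0 : 0 < s := by
    have := hϑ.1
    have h1 : (0 : ℝ) < d₁ := by exact_mod_cast hd₁
    have h2 : (0 : ℝ) < d₂ := by exact_mod_cast hd₂
    positivity
  have hlim : Tendsto (fun ε : ℝ => ENNReal.ofReal (C' * ε ^ s)) (𝓝[>] 0) (𝓝 0) := by
    have h1 : Tendsto (fun ε : ℝ => C' * ε ^ s) (𝓝[>] 0) (𝓝 (C' * 0 ^ s)) :=
      (((Real.continuousAt_rpow_const 0 s (Or.inr hs0.le)).tendsto).const_mul C').mono_left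
        nhdsWithin_le_nhds
    rw [Real.zero_rpow hs0.ne', mul_zero] at h1
    simpa using ENNReal.tendsto_ofReal h1
  refine tendsto_of_tendsto_of_tendsto_of_le_of_le' tendsto_const_nhds hlim
    (Eventually.of_forall fun _ => zero_le) ?_
  filter_upwards [self_mem_nhdsWithin] with ε hε using hdec ε hε

end Decay

/-! ### Oscillatory integrals with phase `cos θ` -/

section Oscillatory

open intervalIntegral

/-- The phase factor `exp (i t cos θ)`. -/
noncomputable def cosPhase (t θ : ℝ) : ℂ := Complex.exp ((t * Real.cos θ : ℝ) * Complex.I)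

theorem norm_cosPhase (t θ : ℝ) : ‖cosPhase t θ‖ = 1 := Complex.norm_exp_ofReal_mul_I _

@[fun_prop]
theorem continuous_cosPhase (t : ℝ) : Continuous (cosPhase t) := by
  unfold cosPhase
  fun_prop

theorem hasDerivAt_cosPhase (t θ : ℝ) :
    HasDerivAt (cosPhase t) (-(t * Complex.I) * (Real.sin θ * cosPhase t θ)) θ := by
  have h1 : HasDerivAt (fun θ : ℝ => ((t * Real.cos θ : ℝ) : ℂ) * Complex.I)
      (((t * -Real.sin θ : ℝ) : ℂ) * Complex.I) θ :=
    (((Real.hasDerivAt_cos θ).const_mul t).ofReal_comp).mul_const _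
  refine h1.cexp.congr_deriv ?_
  unfold cosPhase
  push_cast
  ring

/-- Integration by parts, with `sin θ * cosPhase t θ` a derivative up to the factor `-it`. A factor
`sin θ` in the amplitude is therefore worth one power of `t`. -/
theorem integral_mul_sin_mul_cosPhase (t : ℝ) {a b : ℝ} {u u' : ℝ → ℝ}
    (hu : ∀ θ ∈ Set.uIcc a b, HasDerivAt u (u' θ) θ) (hu' : ContinuousOn u' (Set.uIcc a b)) :
    (t * Complex.I) * ∫ θ in a..b, (u θ : ℂ) * (Real.sin θ * cosPhase t θ) =
      (u a : ℂ) * cosPhase t a - (u b : ℂ) * cosPhase t b +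
        ∫ θ in a..b, (u' θ : ℂ) * cosPhase t θ := by
  have h := integral_mul_deriv_eq_deriv_mul (a := a) (b := b) (u := fun θ => (u θ : ℂ))
    (u' := fun θ => (u' θ : ℂ)) (v := cosPhase t)
    (v' := fun θ => -(t * Complex.I) * (Real.sin θ * cosPhase t θ))
    (fun θ hθ => (hu θ hθ).ofReal_comp) (fun θ _ => hasDerivAt_cosPhase t θ)
    (Complex.continuous_ofReal.comp_continuousOn hu').intervalIntegrable
    (Continuous.intervalIntegrable (by fun_prop) _ _)
  have h2 : ∫ θ in a..b, (u θ : ℂ) * (-(t * Complex.I) * (Real.sin θ * cosPhase t θ)) =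
      -(t * Complex.I) * ∫ θ in a..b, (u θ : ℂ) * (Real.sin θ * cosPhase t θ) := by
    rw [← intervalIntegral.integral_const_mul]
    exact integral_congr fun θ _ => by ring
  rw [h2] at h
  linear_combination -h

theorem integral_inv_sin_sq {a b : ℝ} (h : ∀ θ ∈ Set.uIcc a b, Real.sin θ ≠ 0) :
    ∫ θ in a..b, (Real.sin θ ^ 2)⁻¹ =
      Real.cos a / Real.sin a - Real.cos b / Real.sin b := by
  have hd : ∀ θ ∈ Set.uIcc a b, HasDerivAt (fun θ => -(Real.cos θ / Real.sin θ))
      ((Real.sin θ ^ 2)⁻¹) θ := by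
    intro θ hθ
    refine (((Real.hasDerivAt_cos θ).div (Real.hasDerivAt_sin θ) (h θ hθ)).neg).congr_deriv ?_
    have := h θ hθ
    field_simp
    linarith [Real.sin_sq_add_cos_sq θ]
  rw [integral_eq_sub_of_hasDerivAt hd]
  · ring
  · refine ContinuousOn.intervalIntegrable ?_
    exact ContinuousOn.inv₀ (by fun_prop) fun θ hθ => pow_ne_zero _ (h θ hθ)

/-- The phase `s² cos θ` is stationary at `0` and `π`. Intervals of length `δ = s⁻¹` there are
estimated trivially; in between, integration by parts with amplitude `g / sin` gains `s²` and loses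
only `1 / sin δ ≤ 2 s`. -/
theorem norm_integral_mul_cosPhase_le {g g' : ℝ → ℝ} (hg : ∀ θ, HasDerivAt g (g' θ) θ)
    (hg' : Continuous g') (hg1 : ∀ θ, |g θ| ≤ 1) (hg'1 : ∀ θ, |g' θ| ≤ 1) {s : ℝ} (hs : 1 ≤ s) :
    s * ‖∫ θ in (0 : ℝ)..Real.pi, (g θ : ℂ) * cosPhase (s ^ 2) θ‖ ≤ 14 := by
  have hs0 : 0 < s := by linarith
  set δ := s⁻¹ with hδ
  have hδ0 : 0 < δ := by positivity
  have hδ1 : δ ≤ 1 := inv_le_one_of_one_le₀ hs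
  have hπ := Real.pi_gt_three
  have hπ4 := Real.pi_lt_four
  have hgc : Continuous g := continuous_iff_continuousAt.2 fun θ => (hg θ).continuousAt
  have hFc : Continuous fun θ => (g θ : ℂ) * cosPhase (s ^ 2) θ := by fun_prop
  have hFi : ∀ a b, IntervalIntegrable (fun θ => (g θ : ℂ) * cosPhase (s ^ 2) θ) volume a b :=
    fun a b => hFc.intervalIntegrable a b
  have hF1 : ∀ θ, ‖(g θ : ℂ) * cosPhase (s ^ 2) θ‖ ≤ 1 := fun θ => by
    rw [norm_mul, norm_cosPhase, mul_one, Complex.norm_real]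
    exact hg1 θ
  have hI1 : ‖∫ θ in (0 : ℝ)..δ, (g θ : ℂ) * cosPhase (s ^ 2) θ‖ ≤ δ := by
    have := norm_integral_le_of_norm_le_const (a := 0) (b := δ) fun θ _ => hF1 θ
    rwa [sub_zero, abs_of_pos hδ0, one_mul] at this
  have hI3 : ‖∫ θ in (Real.pi - δ)..Real.pi, (g θ : ℂ) * cosPhase (s ^ 2) θ‖ ≤ δ := by
    have := norm_integral_le_of_norm_le_const (a := Real.pi - δ) (b := Real.pi) fun θ _ => hF1 θ
    rwa [sub_sub_cancel, abs_of_pos hδ0, one_mul] at this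
  have hle : δ ≤ Real.pi - δ := by linarith
  have hsin : ∀ θ ∈ Set.uIcc δ (Real.pi - δ), 0 < Real.sin θ := fun θ hθ => by
    rw [Set.uIcc_of_le hle] at hθ
    exact Real.sin_pos_of_pos_of_lt_pi (by linarith [hθ.1]) (by linarith [hθ.2])
  have hsδ : δ / 2 ≤ Real.sin δ := by
    have := Real.mul_le_sin hδ0.le (by linarith)
    refine le_trans ?_ this
    rw [div_eq_inv_mul]
    refine mul_le_mul_of_nonneg_right ?_ hδ0.le
    rw [le_div_iff₀ Real.pi_pos]
    linarith
  have hsδ0 : 0 < Real.sin δ := by linarith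
  have hinv : (Real.sin δ)⁻¹ ≤ 2 * s := by
    rw [inv_le_comm₀ hsδ0 (by positivity), mul_inv, ← hδ]
    linarith
  have hu : ∀ θ ∈ Set.uIcc δ (Real.pi - δ), HasDerivAt (fun θ => g θ / Real.sin θ)
      ((g' θ * Real.sin θ - g θ * Real.cos θ) / Real.sin θ ^ 2) θ := fun θ hθ =>
    (hg θ).div (Real.hasDerivAt_sin θ) (hsin θ hθ).ne'
  have hu'c : ContinuousOn (fun θ => (g' θ * Real.sin θ - g θ * Real.cos θ) / Real.sin θ ^ 2)
      (Set.uIcc δ (Real.pi - δ)) :=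
    ContinuousOn.div (by fun_prop) (by fun_prop) fun θ hθ => pow_ne_zero _ (hsin θ hθ).ne'
  -- The two boundary terms cost `2 s` each. The derivative of `g / sin` is at most `2 / sin²`,
  -- whose integral `4 cot δ` costs `8 s`.
  have hI2 : s ^ 2 * ‖∫ θ in δ..(Real.pi - δ), (g θ : ℂ) * cosPhase (s ^ 2) θ‖ ≤ 12 * s := by
    have h := integral_mul_sin_mul_cosPhase (s ^ 2) hu hu'c
    have h1 : ∫ θ in δ..(Real.pi - δ), ((g θ / Real.sin θ : ℝ) : ℂ) *
        (Real.sin θ * cosPhase (s ^ 2) θ) =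
        ∫ θ in δ..(Real.pi - δ), (g θ : ℂ) * cosPhase (s ^ 2) θ := by
      refine integral_congr fun θ hθ => ?_
      have : (Real.sin θ : ℂ) ≠ 0 := by exact_mod_cast (hsin θ hθ).ne'
      rw [Complex.ofReal_div, ← mul_assoc, div_mul_cancel₀ _ this]
    rw [h1] at h
    have h2 := congrArg norm h
    rw [norm_mul, norm_mul, Complex.norm_I, mul_one, Complex.norm_real, Real.norm_eq_abs,
      abs_of_pos (by positivity)] at h2
    rw [h2]
    have hb : ∀ θ, ∀ x : ℝ, 0 < Real.sin θ → ‖((g θ / Real.sin θ : ℝ) : ℂ) * cosPhase x θ‖ ≤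
        (Real.sin θ)⁻¹ := fun θ x hθ => by
      rw [norm_mul, norm_cosPhase, mul_one, Complex.norm_real, Real.norm_eq_abs, abs_div,
        abs_of_pos hθ, div_eq_mul_inv]
      exact mul_le_of_le_one_left (by positivity) (hg1 θ)
    have hb1 := hb δ (s ^ 2) hsδ0
    have hb2 := (hb (Real.pi - δ) (s ^ 2) (by rwa [Real.sin_pi_sub])).trans_eq
      (by rw [Real.sin_pi_sub])
    have hb3 : ‖∫ θ in δ..(Real.pi - δ),
        (((g' θ * Real.sin θ - g θ * Real.cos θ) / Real.sin θ ^ 2 : ℝ) : ℂ) *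
          cosPhase (s ^ 2) θ‖ ≤ 4 * (Real.sin δ)⁻¹ := by
      have hint : ∫ θ in δ..(Real.pi - δ), 2 * (Real.sin θ ^ 2)⁻¹ =
          4 * (Real.cos δ / Real.sin δ) := by
        rw [intervalIntegral.integral_const_mul,
          integral_inv_sin_sq fun θ hθ => (hsin θ hθ).ne', Real.sin_pi_sub, Real.cos_pi_sub]
        ring
      have hle2 : ‖∫ θ in δ..(Real.pi - δ),
          (((g' θ * Real.sin θ - g θ * Real.cos θ) / Real.sin θ ^ 2 : ℝ) : ℂ) *
            cosPhase (s ^ 2) θ‖ ≤ ∫ θ in δ..(Real.pi - δ), 2 * (Real.sin θ ^ 2)⁻¹ := by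
        refine norm_integral_le_of_norm_le hle (Eventually.of_forall fun θ hθ => ?_) ?_
        · rw [norm_mul, norm_cosPhase, mul_one, Complex.norm_real, Real.norm_eq_abs, abs_div,
            abs_of_nonneg (sq_nonneg (Real.sin θ)), div_eq_mul_inv]
          refine mul_le_mul_of_nonneg_right ?_ (by positivity)
          have h3 : |g' θ * Real.sin θ| ≤ 1 := by
            rw [abs_mul]
            exact mul_le_one₀ (hg'1 θ) (abs_nonneg _) (Real.abs_sin_le_one θ)
          have h4 : |g θ * Real.cos θ| ≤ 1 := by
            rw [abs_mul]
            exact mul_le_one₀ (hg1 θ) (abs_nonneg _) (Real.abs_cos_le_one θ)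
          linarith [abs_sub (g' θ * Real.sin θ) (g θ * Real.cos θ)]
        · refine ContinuousOn.intervalIntegrable (continuousOn_const.mul ?_)
          exact ContinuousOn.inv₀ (by fun_prop) fun θ hθ => pow_ne_zero _ (hsin θ hθ).ne'
      rw [hint] at hle2
      refine hle2.trans ?_
      rw [div_eq_mul_inv]
      have := mul_le_of_le_one_left (inv_pos.2 hsδ0).le (Real.cos_le_one δ)
      linarith
    refine (norm_add_le _ _).trans ?_
    have hb4 := norm_sub_le (((g δ / Real.sin δ : ℝ) : ℂ) * cosPhase (s ^ 2) δ)
      (((g (Real.pi - δ) / Real.sin (Real.pi - δ) : ℝ) : ℂ) * cosPhase (s ^ 2) (Real.pi - δ))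
    linarith
  have hI2' : s * ‖∫ θ in δ..(Real.pi - δ), (g θ : ℂ) * cosPhase (s ^ 2) θ‖ ≤ 12 := by
    have : s * (s * ‖∫ θ in δ..(Real.pi - δ), (g θ : ℂ) * cosPhase (s ^ 2) θ‖) ≤ s * 12 := by
      linarith
    exact le_of_mul_le_mul_left this hs0
  rw [← integral_add_adjacent_intervals (hFi 0 δ) (hFi δ Real.pi),
    ← integral_add_adjacent_intervals (hFi δ (Real.pi - δ)) (hFi (Real.pi - δ) Real.pi)]
  have hsδ1 : s * δ = 1 := mul_inv_cancel₀ hs0.ne'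
  have := norm_add₃_le (a := ∫ θ in (0 : ℝ)..δ, (g θ : ℂ) * cosPhase (s ^ 2) θ)
    (b := ∫ θ in δ..(Real.pi - δ), (g θ : ℂ) * cosPhase (s ^ 2) θ)
    (c := ∫ θ in (Real.pi - δ)..Real.pi, (g θ : ℂ) * cosPhase (s ^ 2) θ)
  rw [add_assoc] at this
  nlinarith

/-- The Bessel-type integral `∫₀^π sin^n θ exp (i t cos θ) dθ`. -/
noncomputable def sinCosIntegral (n : ℕ) (t : ℝ) : ℂ :=
  ∫ θ in (0 : ℝ)..Real.pi, ((Real.sin θ ^ n : ℝ) : ℂ) * cosPhase t θ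

theorem norm_sinCosIntegral_le (n : ℕ) (t : ℝ) : ‖sinCosIntegral n t‖ ≤ Real.pi := by
  have := norm_integral_le_of_norm_le_const (a := 0) (b := Real.pi) (C := 1)
    (f := fun θ => ((Real.sin θ ^ n : ℝ) : ℂ) * cosPhase t θ) fun θ _ => by
      rw [norm_mul, norm_cosPhase, mul_one, Complex.norm_real, Real.norm_eq_abs, abs_pow]
      exact pow_le_one₀ (abs_nonneg _) (Real.abs_sin_le_one θ)
  rwa [sub_zero, abs_of_pos Real.pi_pos, one_mul] at this

/-- Integration by parts with amplitude `sin ^ n`, whose boundary values survive only for `n = 0`.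
The truncated `n - 1` is harmless, being multiplied by `n`. -/
theorem sinCosIntegral_succ_eq (n : ℕ) (t : ℝ) :
    (t * Complex.I) * sinCosIntegral (n + 1) t =
      ((0 : ℝ) ^ n : ℝ) * (cosPhase t 0 - cosPhase t Real.pi) +
        n * ∫ θ in (0 : ℝ)..Real.pi,
          ((Real.sin θ ^ (n - 1) * Real.cos θ : ℝ) : ℂ) * cosPhase t θ := by
  have h := integral_mul_sin_mul_cosPhase t (a := 0) (b := Real.pi) (u := fun θ => Real.sin θ ^ n)
    (u' := fun θ => n * Real.sin θ ^ (n - 1) * Real.cos θ)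
    (fun θ _ => (Real.hasDerivAt_sin θ).pow n) (by fun_prop)
  simp only [Real.sin_zero, Real.sin_pi] at h
  have h1 : ∫ θ in (0 : ℝ)..Real.pi, ((Real.sin θ ^ n : ℝ) : ℂ) * (Real.sin θ * cosPhase t θ) =
      sinCosIntegral (n + 1) t := by
    refine integral_congr fun θ _ => ?_
    simp only [pow_succ]
    push_cast
    ring
  have h2 : ∫ θ in (0 : ℝ)..Real.pi,
      ((n * Real.sin θ ^ (n - 1) * Real.cos θ : ℝ) : ℂ) * cosPhase t θ =
      n * ∫ θ in (0 : ℝ)..Real.pi,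
        ((Real.sin θ ^ (n - 1) * Real.cos θ : ℝ) : ℂ) * cosPhase t θ := by
    rw [← intervalIntegral.integral_const_mul]
    refine integral_congr fun θ _ => ?_
    push_cast
    ring
  rw [h1, h2] at h
  rw [h]
  ring

/-- Integration by parts with amplitude `sin ^ n * cos`; replacing `cos²` by `1 - sin²` in its
derivative returns to integrals of pure powers of `sin`. -/
theorem integral_sin_pow_succ_mul_cos_eq (n : ℕ) (t : ℝ) :
    (t * Complex.I) * ∫ θ in (0 : ℝ)..Real.pi,
        ((Real.sin θ ^ (n + 1) * Real.cos θ : ℝ) : ℂ) * cosPhase t θ =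
      ((0 : ℝ) ^ n : ℝ) * (cosPhase t 0 + cosPhase t Real.pi) +
        n * sinCosIntegral (n - 1) t - (n + 1) * sinCosIntegral (n + 1) t := by
  have h := integral_mul_sin_mul_cosPhase t (a := 0) (b := Real.pi)
    (u := fun θ => Real.sin θ ^ n * Real.cos θ)
    (u' := fun θ => n * Real.sin θ ^ (n - 1) - (n + 1) * Real.sin θ ^ (n + 1))
    (fun θ _ => by
      refine (((Real.hasDerivAt_sin θ).pow n).mul (Real.hasDerivAt_cos θ)).congr_deriv ?_
      rcases n with _ | n
      · simp
      · simp only [Nat.add_sub_cancel, Pi.pow_apply]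
        push_cast
        linear_combination ((n : ℝ) + 1) * Real.sin θ ^ n * Real.sin_sq_add_cos_sq θ)
    (by fun_prop)
  simp only [Real.sin_zero, Real.sin_pi, Real.cos_zero, Real.cos_pi] at h
  have h1 : ∫ θ in (0 : ℝ)..Real.pi, ((Real.sin θ ^ n * Real.cos θ : ℝ) : ℂ) *
      (Real.sin θ * cosPhase t θ) = ∫ θ in (0 : ℝ)..Real.pi,
        ((Real.sin θ ^ (n + 1) * Real.cos θ : ℝ) : ℂ) * cosPhase t θ := by
    refine integral_congr fun θ _ => ?_
    simp only [pow_succ]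
    push_cast
    ring
  have h2 : ∫ θ in (0 : ℝ)..Real.pi,
      ((n * Real.sin θ ^ (n - 1) - (n + 1) * Real.sin θ ^ (n + 1) : ℝ) : ℂ) * cosPhase t θ =
      n * sinCosIntegral (n - 1) t - (n + 1) * sinCosIntegral (n + 1) t := by
    simp only [sinCosIntegral]
    rw [← intervalIntegral.integral_const_mul, ← intervalIntegral.integral_const_mul,
      ← intervalIntegral.integral_sub (Continuous.intervalIntegrable (by fun_prop) _ _)
        (Continuous.intervalIntegrable (by fun_prop) _ _)]
    refine integral_congr fun θ _ => ?_
    push_cast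
    ring
  rw [h1, h2] at h
  rw [h]
  push_cast
  ring

theorem norm_cosPhase_comb_le (c : ℝ) (hc : |c| ≤ 1) (t : ℝ) :
    ‖(c : ℂ) * (cosPhase t 0 + cosPhase t Real.pi)‖ ≤ 2 ∧
      ‖(c : ℂ) * (cosPhase t 0 - cosPhase t Real.pi)‖ ≤ 2 := by
  have h1 := norm_add_le (cosPhase t 0) (cosPhase t Real.pi)
  have h2 := norm_sub_le (cosPhase t 0) (cosPhase t Real.pi)
  simp only [norm_cosPhase] at h1 h2
  constructor
  · rw [norm_mul, Complex.norm_real, Real.norm_eq_abs]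
    nlinarith [abs_nonneg c, norm_nonneg (cosPhase t 0 + cosPhase t Real.pi)]
  · rw [norm_mul, Complex.norm_real, Real.norm_eq_abs]
    nlinarith [abs_nonneg c, norm_nonneg (cosPhase t 0 - cosPhase t Real.pi)]

/-- Writing `t = s²` keeps the decay `t^{-(n+1)/2}` in integer powers. Two integrations by parts
express `t²` times the integral of index `m + 3` through those of indices `m + 1` and `m - 1`.
Indices `0` and `2` rest on the stationary phase bound, index `1` on the boundary terms alone. -/
theorem exists_pow_mul_norm_sinCosIntegral_le (n : ℕ) :
    ∃ C : ℝ, ∀ s : ℝ, 1 ≤ s → s ^ (n + 1) * ‖sinCosIntegral n (s ^ 2)‖ ≤ C := by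
  have hnorm : ∀ s : ℝ, ∀ z : ℂ, ‖((s ^ 2 : ℝ) : ℂ) * Complex.I * z‖ = s ^ 2 * ‖z‖ := fun s z => by
    rw [norm_mul, norm_mul, Complex.norm_I, mul_one, Complex.norm_real, Real.norm_eq_abs,
      abs_of_nonneg (sq_nonneg s)]
  induction n using Nat.strong_induction_on with
  | _ n ih =>
    match n, ih with
    | 0, _ =>
      refine ⟨14, fun s hs => ?_⟩
      have := norm_integral_mul_cosPhase_le (g := fun _ => 1) (g' := fun _ => 0)
        (fun θ => hasDerivAt_const θ 1) continuous_const (by simp) (by simp) hs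
      simpa [sinCosIntegral] using this
    | 1, _ =>
      refine ⟨2, fun s hs => ?_⟩
      have h := congrArg norm (sinCosIntegral_succ_eq 0 (s ^ 2))
      rw [hnorm] at h
      simp only [Nat.cast_zero, zero_mul, add_zero] at h
      rw [show s ^ (1 + 1) = s ^ 2 by ring, h]
      exact (norm_cosPhase_comb_le _ (by simp) _).2
    | 2, _ =>
      refine ⟨14, fun s hs => ?_⟩
      have h := congrArg norm (sinCosIntegral_succ_eq 1 (s ^ 2))
      rw [hnorm] at h
      simp only [pow_one, Complex.ofReal_zero, zero_mul, zero_add, Nat.cast_one, one_mul,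
        Nat.sub_self, pow_zero] at h
      rw [show s ^ (2 + 1) = s * s ^ 2 by ring, mul_assoc, h]
      exact norm_integral_mul_cosPhase_le (g := Real.cos) (g' := fun θ => -Real.sin θ)
        Real.hasDerivAt_cos (by fun_prop) Real.abs_cos_le_one
        (fun θ => by rw [abs_neg]; exact Real.abs_sin_le_one θ) hs
    | m + 3, ih =>
      obtain ⟨C₁, hC₁⟩ := ih (m + 1) (by omega)
      obtain ⟨C₂, hC₂⟩ : ∃ C : ℝ, ∀ s : ℝ, 1 ≤ s →
          s ^ m * (m * ‖sinCosIntegral (m - 1) (s ^ 2)‖) ≤ C := by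
        rcases m with _ | m
        · exact ⟨0, fun s _ => by simp⟩
        · obtain ⟨C, hC⟩ := ih m (by omega)
          refine ⟨(m + 1) * C, fun s hs => ?_⟩
          have := mul_le_mul_of_nonneg_left (hC s hs) (by positivity : (0 : ℝ) ≤ m + 1)
          simp only [Nat.add_sub_cancel]
          push_cast
          linarith
      -- The factor `m + 2` is from the first integration by parts; `2`, `C₂` and `(m + 1) * C₁`
      -- bound the boundary term and the two lower integrals in the second.
      refine ⟨(m + 2) * (2 + C₂ + (m + 1) * C₁), fun s hs => ?_⟩
      have hs0 : 0 < s := by linarith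
      set J := ∫ θ in (0 : ℝ)..Real.pi,
        ((Real.sin θ ^ (m + 1) * Real.cos θ : ℝ) : ℂ) * cosPhase (s ^ 2) θ with hJ
      have h1 : s ^ 2 * ‖sinCosIntegral (m + 3) (s ^ 2)‖ = (m + 2) * ‖J‖ := by
        have h := congrArg norm (sinCosIntegral_succ_eq (m + 2) (s ^ 2))
        rw [hnorm, show m + 2 - 1 = m + 1 by omega, ← hJ, zero_pow (by omega), Complex.ofReal_zero,
          zero_mul, zero_add, norm_mul, Complex.norm_natCast] at h
        rw [h]
        push_cast
        ring
      have h2 : s ^ m * (s ^ 2 * ‖J‖) ≤ 2 + C₂ + (m + 1) * C₁ := by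
        have h := congrArg norm (integral_sin_pow_succ_mul_cos_eq m (s ^ 2))
        rw [hnorm, ← hJ] at h
        have hz : |(0 : ℝ) ^ m| ≤ 1 := by
          rw [abs_pow, abs_zero]
          exact pow_le_one₀ le_rfl zero_le_one
        have h3 : s ^ m * ‖(((0 : ℝ) ^ m : ℝ) : ℂ) *
            (cosPhase (s ^ 2) 0 + cosPhase (s ^ 2) Real.pi)‖ ≤ 2 := by
          rcases Nat.eq_zero_or_pos m with rfl | hm
          · rw [pow_zero, one_mul]
            exact (norm_cosPhase_comb_le _ hz _).1
          · rw [zero_pow hm.ne']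
            simp
        have h4 := hC₂ s hs
        have h5 : s ^ m * ‖sinCosIntegral (m + 1) (s ^ 2)‖ ≤ C₁ := by
          refine le_trans ?_ (hC₁ s hs)
          exact mul_le_mul_of_nonneg_right (pow_le_pow_right₀ hs (by omega)) (norm_nonneg _)
        have h6 : s ^ 2 * ‖J‖ ≤ ‖(((0 : ℝ) ^ m : ℝ) : ℂ) *
            (cosPhase (s ^ 2) 0 + cosPhase (s ^ 2) Real.pi)‖ +
            m * ‖sinCosIntegral (m - 1) (s ^ 2)‖ +
            (m + 1) * ‖sinCosIntegral (m + 1) (s ^ 2)‖ := by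
          rw [h]
          refine (norm_sub_le _ _).trans (add_le_add ((norm_add_le _ _).trans_eq ?_) (le_of_eq ?_))
          · rw [norm_mul (m : ℂ), Complex.norm_natCast]
          · rw [norm_mul]
            congr 1
            exact_mod_cast Complex.norm_natCast (m + 1)
        have h7 := mul_le_mul_of_nonneg_left h6 (by positivity : 0 ≤ s ^ m)
        have h8 := mul_le_mul_of_nonneg_left h5 (by positivity : (0 : ℝ) ≤ m + 1)
        linarith
      calc s ^ (m + 3 + 1) * ‖sinCosIntegral (m + 3) (s ^ 2)‖
          = (m + 2) * (s ^ m * (s ^ 2 * ‖J‖)) := by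
            rw [show s ^ (m + 3 + 1) = s ^ m * s ^ 2 * s ^ 2 by ring, mul_assoc, h1]
            ring
        _ ≤ _ := by gcongr

end Oscillatory

/-! ### The Fourier transform of the indicator function of a ball -/

section Ball

/-- The identification of `ℝ × ℝ^m` with `ℝ^{m + 1}`. -/
noncomputable def euclideanCons (m : ℕ) (z : ℝ × Euc m) : Euc (m + 1) :=
  WithLp.toLp 2 ((MeasurableEquiv.piFinSuccAbove (fun _ : Fin (m + 1) => ℝ) 0).symm
    (z.1, WithLp.ofLp z.2))

theorem measurePreserving_euclideanCons (m : ℕ) : MeasurePreserving (euclideanCons m) :=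
  (PiLp.volume_preserving_toLp (Fin (m + 1))).comp
    ((volume_preserving_piFinSuccAbove (fun _ : Fin (m + 1) => ℝ) 0).symm.comp
      ((MeasurePreserving.id volume).prod (PiLp.volume_preserving_ofLp (Fin m))))

theorem euclideanCons_zero (m : ℕ) (z : ℝ × Euc m) : euclideanCons m z 0 = z.1 := rfl

theorem euclideanCons_succ (m : ℕ) (z : ℝ × Euc m) (i : Fin m) :
    euclideanCons m z i.succ = z.2 i := rfl

theorem norm_euclideanCons_sq (m : ℕ) (z : ℝ × Euc m) :
    ‖euclideanCons m z‖ ^ 2 = z.1 ^ 2 + ‖z.2‖ ^ 2 := by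
  simp only [EuclideanSpace.norm_sq_eq, Fin.sum_univ_succ, euclideanCons_zero, euclideanCons_succ,
    Real.norm_eq_abs, sq_abs]

theorem euclideanCons_mem_ball {m : ℕ} {r : ℝ} (hr : 0 < r) (s : ℝ) (w : Euc m) :
    euclideanCons m (s, w) ∈ ball (0 : Euc (m + 1)) r ↔
      s ∈ Set.Ioo (-r) r ∧ w ∈ ball (0 : Euc m) (√(r ^ 2 - s ^ 2)) := by
  rw [mem_ball_zero_iff, mem_ball_zero_iff, ← pow_lt_pow_iff_left₀ (norm_nonneg _) hr.le two_ne_zero,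
    norm_euclideanCons_sq, Real.lt_sqrt (norm_nonneg _), Set.mem_Ioo, ← abs_lt]
  constructor
  · intro h
    refine ⟨abs_lt_of_sq_lt_sq (by nlinarith [sq_nonneg ‖w‖]) hr.le, by linarith⟩
  · rintro ⟨-, h⟩
    linarith

/-- On the slice `x 0 = s` the character is constant, and the slice of the ball is an `m`-ball of
radius `√(r² - s²)`. The substitution `s = -r cos θ` makes this radius `r sin θ`, and the Jacobian
adds one more factor `r sin θ`. -/
theorem fourier_indicator_ball_single (m : ℕ) {r : ℝ} (hr : 0 < r) (τ : ℝ) :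
    𝓕 ((ball (0 : Euc (m + 1)) r).indicator fun _ => (1 : ℂ)) (EuclideanSpace.single 0 τ) =
      ((volume (ball (0 : Euc m) 1)).toReal * r ^ (m + 1) : ℝ) *
        sinCosIntegral (m + 1) (2 * Real.pi * τ * r) := by
  set V := (volume (ball (0 : Euc m) 1)).toReal with hV
  set F : Euc (m + 1) → ℂ := (ball (0 : Euc (m + 1)) r).indicator
    fun x => Complex.exp (((-2 * Real.pi * τ * x 0 : ℝ) : ℂ) * Complex.I) with hF
  set g : ℝ → ℂ := fun s => Complex.exp (((-2 * Real.pi * τ * s : ℝ) : ℂ) * Complex.I) *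
    ((√(r ^ 2 - s ^ 2) ^ m * V : ℝ) : ℂ) with hg
  have hFc : Continuous fun x : Euc (m + 1) =>
      Complex.exp (((-2 * Real.pi * τ * x 0 : ℝ) : ℂ) * Complex.I) := by fun_prop
  have hFi : Integrable F := by
    rw [hF, integrable_indicator_iff measurableSet_ball]
    refine Integrable.mono' (g := fun _ => 1) (integrableOn_const measure_ball_lt_top.ne)
      hFc.aestronglyMeasurable (Eventually.of_forall fun x => ?_)
    rw [Complex.norm_exp_ofReal_mul_I]
  have h1 : 𝓕 ((ball (0 : Euc (m + 1)) r).indicator fun _ => (1 : ℂ))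
      (EuclideanSpace.single 0 τ) = ∫ x, F x := by
    rw [Real.fourier_eq']
    refine integral_congr_ae (Eventually.of_forall fun x => ?_)
    by_cases hx : x ∈ ball (0 : Euc (m + 1)) r
    · simp only [hF, Set.indicator_of_mem hx, EuclideanSpace.inner_single_right]
      simp [mul_assoc]
    · simp only [hF, Set.indicator_of_notMem hx, smul_zero]
  have hmp := measurePreserving_euclideanCons m
  have h2 : ∫ x, F x = ∫ s : ℝ, ∫ w : Euc m, F (euclideanCons m (s, w)) := by
    have hFs : AEStronglyMeasurable F (Measure.map (euclideanCons m) volume) := by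
      rw [hmp.map_eq]
      exact hFi.aestronglyMeasurable
    rw [← hmp.map_eq, integral_map hmp.measurable.aemeasurable hFs]
    exact integral_prod _ (hmp.integrable_comp_of_integrable hFi)
  have h3 : ∀ s : ℝ, ∫ w : Euc m, F (euclideanCons m (s, w)) =
      (Set.Ioo (-r) r).indicator g s := by
    intro s
    by_cases hs : s ∈ Set.Ioo (-r) r
    · rw [Set.indicator_of_mem hs]
      have hρ : 0 < √(r ^ 2 - s ^ 2) := Real.sqrt_pos.2 (by
        have := sq_lt_sq' hs.1 hs.2
        linarith)
      have : ∀ w : Euc m, F (euclideanCons m (s, w)) =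
          (ball (0 : Euc m) (√(r ^ 2 - s ^ 2))).indicator
            (fun _ => Complex.exp (((-2 * Real.pi * τ * s : ℝ) : ℂ) * Complex.I)) w := by
        intro w
        have hiff := euclideanCons_mem_ball hr s w
        by_cases hw : w ∈ ball (0 : Euc m) (√(r ^ 2 - s ^ 2))
        · simp only [hF, Set.indicator_of_mem hw, Set.indicator_of_mem (hiff.2 ⟨hs, hw⟩),
            euclideanCons_zero]
        · simp only [hF, Set.indicator_of_notMem hw,
            Set.indicator_of_notMem fun h => hw (hiff.1 h).2]
      simp only [this]
      rw [integral_indicator_const _ measurableSet_ball, Measure.real,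
        Measure.addHaar_ball_of_pos _ _ hρ, finrank_euclideanSpace_fin, ENNReal.toReal_mul,
        ENNReal.toReal_ofReal (by positivity), Complex.real_smul, mul_comm]
    · rw [Set.indicator_of_notMem hs]
      have : ∀ w : Euc m, F (euclideanCons m (s, w)) = 0 := fun w =>
        Set.indicator_of_notMem (fun h => hs ((euclideanCons_mem_ball hr s w).1 h).1) _
      simp [this]
  have hgc : Continuous g := by fun_prop
  rw [h1, h2]
  simp only [h3]
  rw [integral_indicator measurableSet_Ioo, ← integral_Ioc_eq_integral_Ioo,
    ← intervalIntegral.integral_of_le (by linarith)]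
  have hsub := intervalIntegral.integral_deriv_smul_comp (a := 0) (b := Real.pi)
    (f := fun θ => -r * Real.cos θ) (f' := fun θ => r * Real.sin θ) (g := g)
    (fun θ _ => ((Real.hasDerivAt_cos θ).const_mul (-r)).congr_deriv (by ring))
    (by fun_prop) hgc
  simp only [Real.cos_zero, Real.cos_pi, mul_one, mul_neg, neg_neg] at hsub
  rw [← hsub, sinCosIntegral, ← intervalIntegral.integral_const_mul]
  refine intervalIntegral.integral_congr fun θ hθ => ?_
  rw [Set.uIcc_of_le Real.pi_pos.le] at hθ
  have hsin : 0 ≤ Real.sin θ := Real.sin_nonneg_of_mem_Icc hθ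
  have hsqrt : √(r ^ 2 - (-r * Real.cos θ) ^ 2) = r * Real.sin θ := by
    rw [show r ^ 2 - (-r * Real.cos θ) ^ 2 = (r * Real.sin θ) ^ 2 by
      linear_combination (-r ^ 2) * Real.sin_sq_add_cos_sq θ]
    exact Real.sqrt_sq (by positivity)
  have hexp : ((-2 * Real.pi * τ * (-r * Real.cos θ) : ℝ) : ℂ) =
      ((2 * Real.pi * τ * r * Real.cos θ : ℝ) : ℂ) := by
    congr 1
    ring
  simp only [hg, Function.comp, hsqrt, hexp, Complex.real_smul, cosPhase]
  push_cast
  ring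

/-- For `t ≤ 1` the trivial bound `π` suffices; for `t ≥ 1` the power bound is used at `s = √t`. The
factor `2 ^ a` absorbs `1 + t ≤ 2` or `1 + t ≤ 2 t`. -/
theorem exists_norm_sinCosIntegral_le (n : ℕ) :
    ∃ C : ℝ, ∀ t : ℝ, 0 ≤ t → ‖sinCosIntegral n t‖ ≤ C * (1 + t) ^ (-((n : ℝ) + 1) / 2) := by
  obtain ⟨C, hC⟩ := exists_pow_mul_norm_sinCosIntegral_le n
  have hC0 : 0 ≤ C := (by positivity : (0 : ℝ) ≤ 1 ^ (n + 1) * _).trans (hC 1 le_rfl)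
  set a : ℝ := ((n : ℝ) + 1) / 2 with ha
  have ha0 : 0 < a := by positivity
  refine ⟨2 ^ a * (C + Real.pi), fun t ht => ?_⟩
  rw [neg_div, ← ha, Real.rpow_neg (by positivity), ← div_eq_mul_inv, le_div_iff₀ (by positivity)]
  have hπ := Real.pi_pos
  rcases le_total t 1 with h | h
  · calc ‖sinCosIntegral n t‖ * (1 + t) ^ a ≤ Real.pi * 2 ^ a := by
          gcongr
          · exact norm_sinCosIntegral_le n t
          · linarith
      _ ≤ 2 ^ a * (C + Real.pi) := by
          have : (0 : ℝ) < 2 ^ a := by positivity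
          nlinarith
  · have h1 := hC (√t) (Real.one_le_sqrt.2 h)
    rw [Real.sq_sqrt ht] at h1
    have h2 : √t ^ (n + 1) = t ^ a := by
      rw [Real.sqrt_eq_rpow, ← Real.rpow_mul_natCast ht, ha]
      congr 1
      push_cast
      ring
    rw [h2] at h1
    calc ‖sinCosIntegral n t‖ * (1 + t) ^ a ≤ ‖sinCosIntegral n t‖ * (2 * t) ^ a := by
          gcongr
          linarith
      _ = 2 ^ a * (t ^ a * ‖sinCosIntegral n t‖) := by
          rw [Real.mul_rpow zero_le_two ht]
          ring
      _ ≤ 2 ^ a * (C + Real.pi) := by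
          gcongr
          linarith

/-- Moving the centre to `0` multiplies the transform by a unimodular phase, and a reflection, which
preserves the centred ball, carries the first axis to the direction of `ξ`. -/
theorem norm_fourier_indicator_ball (m : ℕ) {r : ℝ} (hr : 0 < r) (c ξ : Euc (m + 1)) :
    ‖𝓕 ((ball c r).indicator fun _ => (1 : ℂ)) ξ‖ =
      (volume (ball (0 : Euc m) 1)).toReal * r ^ (m + 1) *
        ‖sinCosIntegral (m + 1) (2 * Real.pi * ‖ξ‖ * r)‖ := by
  set f : Euc (m + 1) → ℂ := (ball 0 r).indicator fun _ => (1 : ℂ) with hf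
  have h1 : (ball c r).indicator (fun _ => (1 : ℂ)) = f ∘ fun x => x + -c := by
    ext x
    by_cases hx : x ∈ ball c r
    · have hx' : x + -c ∈ ball (0 : Euc (m + 1)) r := by
        rwa [mem_ball_zero_iff, ← sub_eq_add_neg, ← dist_eq_norm]
      rw [Function.comp, hf, Set.indicator_of_mem hx, Set.indicator_of_mem hx']
    · have hx' : x + -c ∉ ball (0 : Euc (m + 1)) r := by
        rwa [mem_ball_zero_iff, ← sub_eq_add_neg, ← dist_eq_norm]
      rw [Function.comp, hf, Set.indicator_of_notMem hx, Set.indicator_of_notMem hx']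
  have h2 : ‖𝓕 (f ∘ fun x => x + -c) ξ‖ = ‖𝓕 f ξ‖ := by
    have := congrFun (VectorFourier.fourierIntegral_comp_add_right Real.fourierChar
      (volume : Measure (Euc (m + 1))) (innerₗ (Euc (m + 1))) f (-c)) ξ
    change ‖VectorFourier.fourierIntegral Real.fourierChar volume (innerₗ (Euc (m + 1)))
      (f ∘ fun x => x + -c) ξ‖ = _
    rw [this, Circle.norm_smul]
    rfl
  set w : Euc (m + 1) := EuclideanSpace.single 0 ‖ξ‖ with hw
  have hwn : ‖w‖ = ‖ξ‖ := by simp [hw]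
  set A := (ℝ ∙ (w - ξ))ᗮ.reflection with hA
  have hAw : A w = ξ := Submodule.reflection_sub hwn
  have h3 : f ∘ A = f := by
    ext x
    by_cases hx : x ∈ ball (0 : Euc (m + 1)) r
    · have hx' : A x ∈ ball (0 : Euc (m + 1)) r := by
        rwa [mem_ball_zero_iff, A.norm_map, ← mem_ball_zero_iff]
      rw [Function.comp, hf, Set.indicator_of_mem hx, Set.indicator_of_mem hx']
    · have hx' : A x ∉ ball (0 : Euc (m + 1)) r := by
        rwa [mem_ball_zero_iff, A.norm_map, ← mem_ball_zero_iff]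
      rw [Function.comp, hf, Set.indicator_of_notMem hx, Set.indicator_of_notMem hx']
  rw [h1, h2, ← hAw, ← Real.fourier_comp_linearIsometry A f w, h3,
    fourier_indicator_ball_single m hr, norm_mul, Complex.norm_real, Real.norm_eq_abs,
    abs_of_nonneg (by positivity), A.norm_map, hwn]

theorem isFourierSmooth_ball {d : ℕ} (hd : 1 ≤ d) (c : Euc d) {r : ℝ} (hr : 0 < r) :
    IsFourierSmooth (ball c r) 1 := by
  obtain ⟨m, rfl⟩ : ∃ m, d = m + 1 := ⟨d - 1, by omega⟩
  refine ⟨one_pos, ?_⟩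
  obtain ⟨C, hC⟩ := exists_norm_sinCosIntegral_le (m + 1)
  have hC0 : 0 ≤ C := by
    have := (norm_nonneg _).trans (hC 0 le_rfl)
    simpa using this
  -- This choice gives `b * (1 + ‖ξ‖) ≤ 1 + 2π r ‖ξ‖`, trading the argument of the Bessel-type
  -- integral for `1 + ‖ξ‖`. The exponent `-(m + 2) / 2` is `-(d + 1) / 2`, so `ϑ = 1`.
  set b := min 1 (2 * Real.pi * r) with hb
  have hb0 : 0 < b := lt_min one_pos (by positivity)
  set a : ℝ := -(((m + 1 : ℕ) : ℝ) + 1) / 2 with ha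
  have ha0 : a ≤ 0 := by
    rw [ha, neg_div, neg_nonpos]
    positivity
  set V := (volume (ball (0 : Euc m) 1)).toReal * r ^ (m + 1) with hV
  refine ⟨V * (C * b ^ a), fun ξ => ?_⟩
  rw [norm_fourier_indicator_ball m hr, mul_assoc V, mul_assoc C]
  refine mul_le_mul_of_nonneg_left ((hC _ (by positivity)).trans
    (mul_le_mul_of_nonneg_left ?_ hC0)) (by positivity)
  rw [← Real.mul_rpow hb0.le (by positivity)]
  refine Real.rpow_le_rpow_of_nonpos (by positivity) ?_ ha0
  have h1 : b ≤ 1 := min_le_left _ _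
  have h2 : b * ‖ξ‖ ≤ 2 * Real.pi * r * ‖ξ‖ :=
    mul_le_mul_of_nonneg_right (min_le_right _ _) (norm_nonneg _)
  linarith

theorem isFourierSmooth_closedBall {d : ℕ} (hd : 1 ≤ d) (c : Euc d) {r : ℝ} (hr : 0 < r) :
    IsFourierSmooth (closedBall c r) 1 := by
  obtain ⟨h0, C, hC⟩ := isFourierSmooth_ball hd c hr
  have : Nonempty (Fin d) := ⟨⟨0, hd⟩⟩
  refine ⟨h0, C, fun ξ => ?_⟩
  -- The sphere is a null set, so both indicators have the same transform.
  have hae : (closedBall c r : Set (Euc d)) =ᵐ[volume] ball c r :=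
    (ae_eq_of_subset_of_measure_ge ball_subset_closedBall
      (Measure.addHaar_closedBall_eq_addHaar_ball volume c r).le
      measurableSet_ball.nullMeasurableSet measure_closedBall_lt_top.ne).symm
  rw [Real.fourier_congr_ae (indicator_ae_eq_of_ae_eq_set hae)]
  exact hC ξ

end Ball

end CutProject

/-! ### Both statements for arithmetic dual lattices. -/

theorem mainTheorem6
    {K : Type*} [Field K] [NumberField K] [NumberField.IsTotallyReal K]
    {d₁ d₂ : ℕ} (hd₁ : 1 ≤ d₁) (hd₂ : 1 ≤ d₂) (hdeg : Module.finrank ℚ K = d₁ + d₂)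
    (σ : Fin d₁ ⊕ Fin d₂ ≃ (K →+* ℝ))
    (Γ : Submodule ℤ (CutProject.Euc d₁ × CutProject.Euc d₂))
    [DiscreteTopology Γ] [IsZLattice ℝ Γ]
    (hΓ : CutProject.IsCutProjectLattice Γ)
    (harith : CutProject.dualLattice Γ = CutProject.arithmeticLattice σ) :
    (∀ (W : Set (CutProject.Euc d₂)) (ϑ : ℝ),
      CutProject.IsWindow W → CutProject.IsFourierSmooth W ϑ →
        CutProject.IsHyperuniform (CutProject.torusMeasure Γ)
            (CutProject.cutProjectProcess Γ W) ∧
          CutProject.DiffractionDecay (CutProject.torusMeasure Γ)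
            (CutProject.cutProjectProcess Γ W) ((d₁ : ℝ) * ϑ / d₂)) ∧
    (∀ (W : Set (CutProject.Euc d₂)) (c : CutProject.Euc d₂) (r : ℝ), 0 < r →
      (W = ball c r ∨ W = closedBall c r) →
        CutProject.IsHyperuniform (CutProject.torusMeasure Γ)
            (CutProject.cutProjectProcess Γ W) ∧
          CutProject.DiffractionDecay (CutProject.torusMeasure Γ)
            (CutProject.cutProjectProcess Γ W) ((d₁ : ℝ) / d₂)) := by
  -- All that is used of the arithmetic structure is this lower bound on products of coordinates.
  have hS : ∀ ξ ∈ CutProject.dualLattice Γ, ξ ≠ 0 →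
      1 ≤ (∏ i, |ξ.1 i|) * ∏ j, |ξ.2 j| := fun ξ hξ h0 =>
    CutProject.one_le_prod_abs_of_mem_arithmeticLattice hdeg σ.injective (harith ▸ hξ) h0
  refine ⟨fun W ϑ hW hϑ => ⟨?_, ?_⟩, fun W c r hr hWb => ?_⟩
  · exact CutProject.isHyperuniform_cutProjectProcess hd₁ hd₂ hΓ hS hW.measurableSet
      hW.isBounded hϑ
  · exact CutProject.diffractionDecay_cutProjectProcess hd₁ hd₂ hΓ hS hW.measurableSet
      hW.isBounded hϑ
  · obtain ⟨hWm, hWb', hϑ⟩ : MeasurableSet W ∧ Bornology.IsBounded W ∧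
        CutProject.IsFourierSmooth W 1 := by
      rcases hWb with rfl | rfl
      · exact ⟨measurableSet_ball, isBounded_ball, CutProject.isFourierSmooth_ball hd₂ c hr⟩
      · exact ⟨measurableSet_closedBall, isBounded_closedBall,
          CutProject.isFourierSmooth_closedBall hd₂ c hr⟩
    refine ⟨CutProject.isHyperuniform_cutProjectProcess hd₁ hd₂ hΓ hS hWm hWb' hϑ, ?_⟩
    have := CutProject.diffractionDecay_cutProjectProcess hd₁ hd₂ hΓ hS hWm hWb' hϑ
    rwa [mul_one] at this
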